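/- **Setting.** A base station serves users $1,\dots,K$ only through a reflecting surface with $M=PQ$ elements under on-off control: $V=I_P\otimes \mathbf 1_Q$, $v_p$ is its $p$-th column, and the cascaded channel of user $j$ is $H_j=v_p^H\,\mathrm{diag}(h_{rj}^H)\,h_{br}$. All entries of $h_{br},h_{r1},\dots,h_{rK}$ and the residual interferences $h_{ipu},h_{ipe}$ are independent, with $h_{br}^m\sim\mathcal{CN}(0,N_{br})$, $h_{rj}^m\sim\mathcal{CN}(0,N_{rj})$, $h_{ipu}\sim\mathcal{CN}(0,N_{ipu})$, $h_{ipe}\sim\mathcal{CN}(0,N_{ipe})$ (positive mean powers). The power factors satisfy $a_1\ge\dots\ge a_K>0$, $\sum_i a_i=1$; $\nu_k=\sum_{i=k+1}^K a_i$; $\rho,\rho_e>0$ are the transmit SNRs of the legitimate and the eavesdropping channels, and $\varpi\in[0,1]$ is the residual interference level ($\varpi\neq0$: ipSIC, $\varpi=0$: pSIC). For channel gains $X$ (user $k$) and $W$ (eavesdropper) put $$\tilde\gamma_k=\frac{\rho X a_k}{\rho X\nu_k+\varpi\rho|h_{ipu}|^2+1},\qquad \tilde\gamma_{IE\to k}=\frac{\rho_e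 W a_k}{\rho_e W\nu_k+\varpi\rho_e|h_{ipe}|^2+1},$$ $C_k^{IE}=[\log_2(1+\tilde\gamma_k)-\log_2(1+\tilde\gamma_{IE\to k})]^+$. The secrecy outage probability (SOP) of user $k$ for the target secrecy rate $R>0$ is $P(C_k^{IE}<R)$. User $1$, the one with the weakest channel, is the internal eavesdropper. The *approximate SOP* $\tilde P_{out,k}$ is the SOP when the gain $X$ of the $k$-th user in the order of increasing gains is taken to be the $k$-th smallest of $K$ independent random variables with the law of $|H_k|^2$, independent of $h_{ipu},h_{ipe}$, and the wiretap gain $W=|H_1|^2$ is replaced by its mean $\mathbb E|H_1|^2$. **Notation.** $L_n(x)=e^x\frac{d^n}{dx^n}(x^ne^{-x})$ is the Laguerre polynomial; for a zero $\tau$ of $L_n$ let $G_n(\tau)=\frac{(n!)^2}{\tau[L_n'(\tau)]^2}$; $K_Q$ is the modified Bessel function of the second kind; $\kappa=\frac{K!}{(K-k)!(k-1)!}$; $$\zeta_1(\tau)=\frac{\varpi\rho N_{ipu}\tau+1}{\rho N_{br}N_{rk}},\quad \zeta_2=\rho N_{br}N_{rk},\quad \vartheta(\tau)=2^{R}\Big(1+\frac{QN_{br}N_{r1}a_k\rho_e}{\rho_eQN_{br}N_{r1}\nu_k+\varpi\rho_eN_{ipe}\tau+1}\Big)-1,$$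 $\varsigma=2^{R}\Big(1+\frac{QN_{br}N_{r1}a_k\rho_e}{\rho_eQN_{br}N_{r1}\nu_k+1}\Big)-1$, and $$B(\zeta,x)=1-\frac{2}{\Gamma(Q)}z^{Q/2}K_Q(2\sqrt z),\quad z=\frac{\zeta x}{a_k-x\nu_k},\ \text{ if } x\nu_k<a_k,\qquad B(\zeta,x)=1\ \text{ if } x\nu_k\ge a_k .$$ **Theorem.** Let $1<k\le K$ and $R>0$. Then $\mathbb E|H_1|^2=QN_{br}N_{r1}$, and the approximate SOP under internal eavesdropping is given by $$\tilde P_{out,k}\approx\sum_{s=1}^{S}\sum_{l=0}^{K-k}\sum_{d=1}^{D}\frac{\kappa\,G_S(\tau_s)\,G_D(\tau_d)(-1)^l}{k+l}\binom{K-k}{l}\,B\big(\zeta_1(\tau_d),\vartheta(\tau_s)\big)^{k+l},$$ where $\tau_s$ and $\tau_d$ run over the zeros of $L_S$ and $L_D$, with equality in the limit when $S$ and $D$ both tend to infinity (jointly). If $\varpi=0$, then $$\tilde P_{out,k}=\kappa\sum_{l=0}^{K-k}\binom{K-k}{l}\frac{(-1)^l}{k+l}\,B(\zeta_2^{-1},\varsigma)^{k+l}.$$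 -/

import Mathlib

open MeasureTheory ProbabilityTheory Filter Topology
open scoped Kronecker Nat

noncomputable section

namespace RISNOMA

/-! ### Special functions and quadrature -/

/-- Modified Bessel function of the second kind (for `x > 0`),
`K_ν(x) = ∫₀^∞ exp (-x cosh t) cosh (ν t) dt`. -/
def besselK (ν x : ℝ) : ℝ :=
  ∫ t in Set.Ioi (0 : ℝ), Real.exp (-x * Real.cosh t) * Real.cosh (ν * t)

/-- Laguerre polynomial in the normalisation `L_n(x) = eˣ dⁿ/dxⁿ (xⁿ e⁻ˣ)`
(leading coefficient `(-1)ⁿ`, constant coefficient `n!`); this is the normalisation for which the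
Gauss-Laguerre weights are `(n!)² / (τ L_n'(τ)²)`. -/
def laguerre (n : ℕ) : Polynomial ℝ :=
  ∑ j ∈ Finset.range (n + 1),
    Polynomial.monomial j ((-1 : ℝ) ^ j * (n.choose j : ℝ) * ((n ! : ℝ) / (j ! : ℝ)))

/-- The Gauss-Laguerre nodes of order `n`: the zeros of `L_n`. -/
def nodes (n : ℕ) : Finset ℝ := (laguerre n).roots.toFinset

/-- The Gauss-Laguerre weight `G = (n!)² / (τ [L_n'(τ)]²)` of the node `τ`. -/
def weight (n : ℕ) (τ : ℝ) : ℝ :=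
  (n ! : ℝ) ^ 2 / (τ * ((laguerre n).derivative.eval τ) ^ 2)

/-! ### Network parameters -/

/-- Parameters of the network. Users are numbered `1, …, K`; the values of `a` and `Nr` outside of
`1, …, K` are irrelevant. The RIS has `M = P Q` elements. -/
structure Params where
  /-- number of legitimate users -/
  K : ℕ
  /-- number of groups of reflecting elements -/
  P : ℕ
  /-- number of elements that are switched on -/
  Q : ℕ
  /-- power allocation factors -/
  a : ℕ → ℝ
  /-- mean power of a coefficient BS to RIS -/
  Nbr : ℝ
  /-- mean power of a coefficient RIS to the given user -/
  Nr : ℕ → ℝ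
  /-- mean power of the residual interference at a legitimate user -/
  Nipu : ℝ
  /-- mean power of the residual interference at the eavesdropper -/
  Nipe : ℝ
  /-- transmit SNR of the legitimate channels -/
  ρ : ℝ
  /-- transmit SNR of the eavesdropping channel -/
  ρe : ℝ
  /-- residual interference level: `0` for perfect SIC, nonzero for imperfect SIC -/
  ϖ : ℝ

/-- The standing assumptions on the parameters. -/
structure Params.Valid (θ : Params) : Prop where
  P_pos : 0 < θ.P
  Q_pos : 0 < θ.Q
  a_pos : ∀ i ∈ Finset.Icc 1 θ.K, 0 < θ.a i
  a_anti : AntitoneOn θ.a (Set.Icc 1 θ.K)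
  a_sum : ∑ i ∈ Finset.Icc 1 θ.K, θ.a i = 1
  Nbr_pos : 0 < θ.Nbr
  Nr_pos : ∀ i ∈ Finset.Icc 1 θ.K, 0 < θ.Nr i
  Nipu_pos : 0 < θ.Nipu
  Nipe_pos : 0 < θ.Nipe
  ρ_pos : 0 < θ.ρ
  ρe_pos : 0 < θ.ρe
  ϖ_mem : θ.ϖ ∈ Set.Icc (0 : ℝ) 1

/-- `ν_k = ∑_{i=k+1}^K a_i`. -/
def Params.ν (θ : Params) (k : ℕ) : ℝ := ∑ i ∈ Finset.Icc (k + 1) θ.K, θ.a i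

/-! ### Channels -/

/-- The circularly symmetric complex normal law `CN(0, N)`: real and imaginary part are
independent real normal variables with mean `0` and variance `N / 2`. -/
def complexNormal (N : ℝ) : Measure ℂ :=
  ((gaussianReal 0 (N / 2).toNNReal).prod (gaussianReal 0 (N / 2).toNNReal)).map
    Complex.measurableEquivRealProd.symm

/-- The `p`-th column `v_p` of the on-off matrix `V = I_P ⊗ 1_Q`. -/
def onOffColumn (P Q : ℕ) (p : Fin P) : Fin P × Fin Q → ℂ :=
  fun m => ((1 : Matrix (Fin P) (Fin P) ℂ) ⊗ₖ
    (Matrix.of fun _ _ => 1 : Matrix (Fin Q) (Fin 1) ℂ)) m (p, 0)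

/-- The cascaded channel BS-RIS-receiver under on-off control, `v_pᴴ D_r h_br` with
`D_r = diag(h_rᴴ)`. -/
def cascade {P Q : ℕ} (p : Fin P) (hr hbr : Fin P × Fin Q → ℂ) : ℂ :=
  star (onOffColumn P Q p) ⬝ᵥ Matrix.mulVec (Matrix.diagonal (star hr)) hbr

/-- The users `1, …, K`. -/
abbrev User (K : ℕ) : Type := {j : ℕ // 1 ≤ j ∧ j ≤ K}

/-- User `1`, the internal eavesdropper. -/
def User.first {K : ℕ} (k : User K) : User K := ⟨1, le_rfl, k.2.1.trans k.2.2⟩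

/-- The scalar random coefficients of the network: `br m` between the BS and the `m`-th element of
the RIS, `ru j m` between the `m`-th element of the RIS and user `j`, and the residual
interferences `ipu` at the legitimate user and `ipe` at the eavesdropper. -/
inductive Coeff (K P Q : ℕ) : Type
  | br (m : Fin P × Fin Q)
  | ru (j : User K) (m : Fin P × Fin Q)
  | ipu
  | ipe

/-- Mean powers of the coefficients. -/
def Params.power (θ : Params) : Coeff θ.K θ.P θ.Q → ℝ
  | .br _ => θ.Nbr
  | .ru j _ => θ.Nr j
  | .ipu => θ.Nipu
  | .ipe => θ.Nipe

/-- The Rayleigh fading model: the coefficients are independent and `CN(0, ·)`-distributed. -/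
structure IsFading {Ω : Type*} [MeasurableSpace Ω] (μ : Measure Ω) (θ : Params)
    (h : Coeff θ.K θ.P θ.Q → Ω → ℂ) : Prop where
  hasLaw : ∀ c, HasLaw (h c) (complexNormal (θ.power c)) μ
  indep : iIndepFun h μ

/-- The cascaded channel gain `|H_j|²` of user `j` (before sorting). -/
def gain {Ω : Type*} (θ : Params) (p : Fin θ.P) (h : Coeff θ.K θ.P θ.Q → Ω → ℂ) (j : User θ.K)
    (ω : Ω) : ℝ :=
  ‖cascade p (fun m => h (.ru j m) ω) (fun m => h (.br m) ω)‖ ^ 2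

/-- The `k`-th smallest of the numbers `g 0, …, g (K - 1)`, for `1 ≤ k ≤ K`. -/
def kthSmallest {K : ℕ} (g : Fin K → ℝ) (k : ℕ) : ℝ :=
  sInf {x : ℝ | k ≤ (Finset.univ.filter fun j => g j ≤ x).card}

/-- The law of the `k`-th order statistic of `K` independent variables with law `L`. -/
def orderStatLaw (K k : ℕ) (L : Measure ℝ) : Measure ℝ :=
  (Measure.pi fun _ : Fin K => L).map fun g => kthSmallest g k

/-! ### Secrecy outage -/

/-- The SINR for detecting the signal of user `k`, at transmit SNR `r`, channel gain `x` and
residual interference power `y`. -/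
def sinr (θ : Params) (k : ℕ) (r x y : ℝ) : ℝ :=
  r * x * θ.a k / (r * x * θ.ν k + θ.ϖ * r * y + 1)

/-- The secrecy rate `[log₂ (1 + γ) - log₂ (1 + γE)]⁺`. -/
def secrecyRate (γ γE : ℝ) : ℝ := max (Real.logb 2 (1 + γ) - Real.logb 2 (1 + γE)) 0

/-- The secrecy outage probability `P (C_k < R)` of user `k` for the target secrecy rate `R`,
when `N` is the joint law of the four quantities on which `C_k` depends: the channel gain of
user `k`, the gain of the wiretap channel, `|h_ipu|²` and `|h_ipe|²`. -/
def sop (θ : Params) (k : ℕ) (R : ℝ) (N : Measure (ℝ × ℝ × ℝ × ℝ)) : ℝ :=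
  N.real {q | secrecyRate (sinr θ k θ.ρ q.1 q.2.2.1) (sinr θ k θ.ρe q.2.1 q.2.2.2) < R}

/-- The approximate secrecy outage probability of user `k` under internal eavesdropping: the gain
of user `k` is treated as the `k`-th order statistic of `K` independent gains with the law of
`|H_k|²`, and the wiretap gain `|H_1|²` is replaced by its mean. -/
def approxSOP {Ω : Type*} [MeasurableSpace Ω] (μ : Measure Ω) (θ : Params) (p : Fin θ.P)
    (h : Coeff θ.K θ.P θ.Q → Ω → ℂ) (k : User θ.K) (R : ℝ) : ℝ :=
  sop θ k R
    ((orderStatLaw θ.K k (μ.map (gain θ p h k))).prod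
      ((Measure.dirac (∫ ω, gain θ p h k.first ω ∂μ)).prod
        ((μ.map fun ω => ‖h .ipu ω‖ ^ 2).prod (μ.map fun ω => ‖h .ipe ω‖ ^ 2))))

/-! ### The expressions in closed form -/

/-- `κ = K! / ((K - k)! (k - 1)!)`. -/
def Params.κ (θ : Params) (k : ℕ) : ℝ :=
  (θ.K ! : ℝ) / (((θ.K - k) ! : ℝ) * ((k - 1) ! : ℝ))

/-- `ζ₁ = (ϖ ρ N_ipu τ + 1) / (ρ N_br N_rk)`. -/
def Params.ζ₁ (θ : Params) (k : ℕ) (τ : ℝ) : ℝ :=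
  (θ.ϖ * θ.ρ * θ.Nipu * τ + 1) / (θ.ρ * θ.Nbr * θ.Nr k)

/-- `ζ₂ = ρ N_br N_rk`. -/
def Params.ζ₂ (θ : Params) (k : ℕ) : ℝ := θ.ρ * θ.Nbr * θ.Nr k

/-- The threshold
`ϑ = 2^R (1 + Q N_br N_r1 a_k ρ_e / (ρ_e Q N_br N_r1 ν_k + ϖ ρ_e N_ipe τ + 1)) - 1`. -/
def Params.ϑ (θ : Params) (k : ℕ) (R τ : ℝ) : ℝ :=
  (2 : ℝ) ^ R * (1 + (θ.Q : ℝ) * θ.Nbr * θ.Nr 1 * θ.a k * θ.ρe /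
    (θ.ρe * θ.Q * θ.Nbr * θ.Nr 1 * θ.ν k + θ.ϖ * θ.ρe * θ.Nipe * τ + 1)) - 1

/-- The threshold `ς = 2^R (1 + Q N_br N_r1 a_k ρ_e / (ρ_e Q N_br N_r1 ν_k + 1)) - 1`. -/
def Params.ς (θ : Params) (k : ℕ) (R : ℝ) : ℝ :=
  (2 : ℝ) ^ R * (1 + (θ.Q : ℝ) * θ.Nbr * θ.Nr 1 * θ.a k * θ.ρe /
    (θ.ρe * θ.Q * θ.Nbr * θ.Nr 1 * θ.ν k + 1)) - 1

/-- `1 - (2 / Γ(Q)) z^(Q/2) K_Q(2 √z)` with `z = ζ x / (a_k - x ν_k)`; when `a_k ≤ x ν_k` the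
threshold `x` cannot be exceeded by the SINR, and the term has the value `1`, its limit for
`z → ∞`. -/
def Params.base (θ : Params) (k : ℕ) (ζ x : ℝ) : ℝ :=
  if x * θ.ν k < θ.a k then
    1 - 2 / Real.Gamma θ.Q * (ζ * x / (θ.a k - x * θ.ν k)) ^ ((θ.Q : ℝ) / 2) *
      besselK θ.Q (2 * √(ζ * x / (θ.a k - x * θ.ν k)))
  else 1

/-- The approximate expression with imperfect SIC, with `S` and `D` quadrature nodes. -/
def Params.sopIpSIC (θ : Params) (k : ℕ) (R : ℝ) (S D : ℕ) : ℝ :=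
  ∑ τs ∈ nodes S, ∑ l ∈ Finset.range (θ.K - k + 1), ∑ τd ∈ nodes D,
    θ.κ k * weight S τs * weight D τd * (-1) ^ l / ((k : ℝ) + l) * ((θ.K - k).choose l : ℝ) *
      θ.base k (θ.ζ₁ k τd) (θ.ϑ k R τs) ^ (k + l)

/-- The expression with perfect SIC. -/
def Params.sopPSIC (θ : Params) (k : ℕ) (R : ℝ) : ℝ :=
  θ.κ k * ∑ l ∈ Finset.range (θ.K - k + 1),
    ((θ.K - k).choose l : ℝ) * ((-1) ^ l / ((k : ℝ) + l)) *
      θ.base k (θ.ζ₂ k)⁻¹ (θ.ς k R) ^ (k + l)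

end RISNOMA

end

/-! Condition on the BS-RIS coefficients `b`. The cascade is then a linear combination of
independent circular normals, hence `CN(0, N_rj ∑ ‖b m‖²)` with the sum over the `Q` active
elements, and its squared modulus is exponential (`map_cascade`). The normalised sum has the gamma
law of shape `Q` and unit rate. Averaging the exponential tail over it gives the Bessel expression
(`map_gain_Iio`, `integral_exp_neg_div_gammaMeasure_one`); averaging the conditional mean gives the
mean gain (`integral_gain`). The distribution function of the order statistic is a binomial tail,
hence a polynomial in that of the gain (`orderStatLaw_Iio`).

Once the wiretap gain is a constant, secrecy outage means that the SINR of user `k` stays below the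
threshold `ϑ`. This bounds the gain from above, or holds for every gain when `a_k ≤ ϑ ν_k`. The
normalised interference powers are independent unit exponentials, so the approximate SOP is the mean
of `condOutage` under the product of two unit exponential laws (`approxSOP_eq_integral`). For `ϖ =
0` the integrand is constant, which is the second formula.

The double quadrature sum is the integral of the same function against a product of two
Gauss-Laguerre rules. For positive order these are probability measures, exact in degrees below `2n`
(`sum_weight_mul_eval`), so every fixed moment eventually equals that of the exponential law. The
moments `j!` grow slowly enough for Taylor expansion of the characteristic functions with steps of
length at most `1/2`, whence weak convergence (`tendsto_quadProbability`). Weak convergence passes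
to products, which yields the joint limit for bounded continuous integrands. `condOutage` is one: it
has no jump where the SINR saturates, because the tail of the gain vanishes at infinity
(`continuous_gammaTail`). -/

noncomputable section

namespace RISNOMA

/-! ### Laguerre polynomials and Gauss-Laguerre quadrature -/

open Polynomial in
/-- The linear functional `p ↦ ∫₀^∞ p(x) e⁻ˣ dx` on polynomials, given by the moments `j!`. -/
def expFunctional : ℝ[X] →ₗ[ℝ] ℝ :=
  Polynomial.lsum fun j => (j ! : ℝ) • LinearMap.id

section Laguerre
open Polynomial

lemma expFunctional_monomial (j : ℕ) (c : ℝ) :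
    expFunctional (monomial j c) = (j ! : ℝ) * c := by
  simp [expFunctional, Polynomial.lsum_apply, Polynomial.sum_monomial_index]

lemma expFunctional_X_pow (j : ℕ) : expFunctional (X ^ j) = (j ! : ℝ) := by
  rw [← monomial_one_right_eq_X_pow, expFunctional_monomial, mul_one]

lemma coeff_laguerre (n j : ℕ) :
    (laguerre n).coeff j = (-1 : ℝ) ^ j * (n.choose j : ℝ) * ((n ! : ℝ) / (j ! : ℝ)) := by
  simp only [laguerre, finsetSum_coeff, coeff_monomial]
  by_cases hj : j ∈ Finset.range (n + 1)
  · simp [Finset.sum_ite_eq' (Finset.range (n + 1)) j, hj]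
  · rw [Finset.sum_ite_eq', if_neg hj, Nat.choose_eq_zero_of_lt (by simpa using hj)]
    simp

lemma natDegree_laguerre (n : ℕ) : (laguerre n).natDegree = n := by
  refine natDegree_eq_of_le_of_coeff_ne_zero ?_ ?_
  · rw [natDegree_le_iff_coeff_eq_zero]
    intro N hN
    simp [coeff_laguerre, Nat.choose_eq_zero_of_lt hN]
  · simp [coeff_laguerre, Nat.factorial_ne_zero]

lemma leadingCoeff_laguerre (n : ℕ) : (laguerre n).leadingCoeff = (-1) ^ n := by
  rw [leadingCoeff, natDegree_laguerre, coeff_laguerre]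
  have : (n ! : ℝ) ≠ 0 := by positivity
  simp [this]

lemma laguerre_ne_zero (n : ℕ) : laguerre n ≠ 0 := by
  intro h
  have := leadingCoeff_laguerre n
  rw [h, leadingCoeff_zero] at this
  exact pow_ne_zero n (by norm_num : (-1 : ℝ) ≠ 0) this.symm

/-- The coefficients alternate in sign, so no term is negative at `x ≤ 0`, and the constant term is
`n!`. Hence all nodes are positive. -/
lemma eval_laguerre_pos {n : ℕ} {x : ℝ} (hx : x ≤ 0) : 0 < (laguerre n).eval x := by
  rw [laguerre, eval_finsetSum]
  have h0 : ∀ j ∈ Finset.range (n + 1), 0 ≤ (monomial j ((-1 : ℝ) ^ j * (n.choose j : ℝ) *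
      ((n ! : ℝ) / (j ! : ℝ)))).eval x := by
    intro j _
    rw [eval_monomial]
    have : (-1 : ℝ) ^ j * (n.choose j : ℝ) * ((n ! : ℝ) / (j ! : ℝ)) * x ^ j =
        (-x) ^ j * ((n.choose j : ℝ) * ((n ! : ℝ) / (j ! : ℝ))) := by
      rw [neg_pow x]; ring
    rw [this]
    have : 0 ≤ -x := by linarith
    positivity
  refine Finset.sum_pos' h0 ⟨0, by simp, ?_⟩
  simp only [eval_monomial]
  simp; positivity

/-- The moment of `x^(i+j)` divided by `j!` is `(j+1)⋯(j+i)`, a polynomial in `j` of degree `i`. The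
signed binomial coefficients of `L_n` turn the sum over `j` into an `n`-th finite difference of it,
which vanishes for `i < n`. -/
lemma expFunctional_X_pow_mul_laguerre (i n : ℕ) :
    expFunctional (X ^ i * laguerre n) = (n ! : ℝ) * ((-1) ^ n *
      (fwdDiff 1)^[n] (fun x => ((ascPochhammer ℝ i).comp (X + 1)).eval x) 0) := by
  rw [fwdDiff_iter_eq_sum_shift, laguerre, Finset.mul_sum, map_sum, Finset.mul_sum, Finset.mul_sum]
  refine Finset.sum_congr rfl fun j hj => ?_
  have hj' : j ≤ n := by simpa [Nat.lt_succ_iff] using hj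
  have h1 : ((ascPochhammer ℝ i).comp (X + 1)).eval (0 + j • (1 : ℝ)) =
      ((j + i)! : ℝ) / (j ! : ℝ) := by
    rw [eval_comp]
    have : (X + 1 : ℝ[X]).eval (0 + j • (1 : ℝ)) = ((j + 1 : ℕ) : ℝ) := by simp
    rw [this, ← ascPochhammer_eval_cast, ascPochhammer_nat_eq_ascFactorial, eq_div_iff (by positivity),
      ← Nat.factorial_mul_ascFactorial j i]
    push_cast; ring
  rw [X_pow_mul_monomial, expFunctional_monomial, h1, zsmul_eq_mul]
  have h2 : (-1 : ℝ) ^ n * (-1) ^ (n - j) = (-1) ^ j := by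
    rw [← pow_add, show n + (n - j) = j + 2 * (n - j) by omega, pow_add, pow_mul]; simp
  push_cast
  rw [← h2]
  ring

lemma natDegree_ascPochhammer_shift (i : ℕ) :
    ((ascPochhammer ℝ i).comp (X + 1)).natDegree = i := by
  rw [natDegree_comp, ascPochhammer_natDegree, ← C_1, natDegree_X_add_C, mul_one]

lemma leadingCoeff_ascPochhammer_shift (i : ℕ) :
    ((ascPochhammer ℝ i).comp (X + 1)).leadingCoeff = 1 := by
  have h : (X + 1 : ℝ[X]).natDegree = 1 := by rw [← C_1, natDegree_X_add_C]
  rw [leadingCoeff_comp (by rw [h]; norm_num), (monic_ascPochhammer ℝ i).leadingCoeff, one_mul,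
    ← C_1, leadingCoeff_X_add_C, one_pow]

/-- Orthogonality of the Laguerre polynomials to lower degrees, together with the pairing with
degree `n`. -/
lemma expFunctional_mul_laguerre {n : ℕ} {q : ℝ[X]} (hq : q.natDegree ≤ n) :
    expFunctional (q * laguerre n) = q.coeff n * ((-1) ^ n * (n ! : ℝ) ^ 2) := by
  conv_lhs => rw [q.as_sum_range_C_mul_X_pow' (Nat.lt_succ_of_le hq)]
  rw [Finset.sum_mul, map_sum, Finset.sum_range_succ, Finset.sum_eq_zero, zero_add]
  · rw [mul_assoc, ← smul_eq_C_mul, map_smul, expFunctional_X_pow_mul_laguerre]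
    -- For `i = n` the polynomial is monic of degree `n`, so its `n`-th difference is the constant
    -- `n!`: this is the second factor `n!`.
    have := Polynomial.fwdDiff_iter_degree_eq_factorial ((ascPochhammer ℝ n).comp (X + 1))
    rw [natDegree_ascPochhammer_shift, leadingCoeff_ascPochhammer_shift] at this
    rw [this]
    simp only [Pi.smul_apply, Pi.natCast_apply, smul_eq_mul]
    ring
  · intro i hi
    rw [mul_assoc, ← smul_eq_C_mul, map_smul, expFunctional_X_pow_mul_laguerre,
      Polynomial.fwdDiff_iter_eq_zero_of_degree_lt]
    · simp
    · rw [natDegree_ascPochhammer_shift]; simpa using hi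

/-- Coefficientwise this is `(n+1-j) C(n+1,j) = (n+1) C(n,j)`. It serves to bring the weights to the
form with `τ L_n'(τ)²`. -/
lemma X_mul_derivative_laguerre (n : ℕ) :
    X * derivative (laguerre (n + 1)) =
      C ((n : ℝ) + 1) * laguerre (n + 1) - C (((n : ℝ) + 1) ^ 2) * laguerre n := by
  ext j
  rw [coeff_sub, coeff_C_mul, coeff_C_mul, coeff_laguerre, coeff_laguerre]
  have key : ((n : ℝ) + 1 - j) * ((n + 1).choose j : ℝ) = ((n : ℝ) + 1) * (n.choose j : ℝ) := by
    rcases le_or_gt j (n + 1) with hj | hj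
    · have := Nat.choose_mul_succ_eq n j
      have h2 : ((n + 1 - j : ℕ) : ℝ) = (n : ℝ) + 1 - j := by rw [Nat.cast_sub hj]; push_cast; ring
      rw [← h2]
      have h3 : ((n.choose j * (n + 1) : ℕ) : ℝ) = (((n + 1).choose j * (n + 1 - j) : ℕ) : ℝ) := by
        rw [this]
      push_cast [-Nat.cast_sub] at h3
      linarith
    · rw [Nat.choose_eq_zero_of_lt hj, Nat.choose_eq_zero_of_lt (by omega)]; simp
  have h4 : (X * derivative (laguerre (n + 1))).coeff j = j * (laguerre (n + 1)).coeff j := by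
    cases j with
    | zero => simp
    | succ j => rw [coeff_X_mul, coeff_derivative]; push_cast; ring
  rw [h4, coeff_laguerre, Nat.factorial_succ]
  push_cast
  have : (j ! : ℝ) ≠ 0 := by positivity
  field_simp
  linear_combination (-1 : ℝ) * key

/-! ### Positivity of the functional -/

lemma integrableOn_pow_mul_exp_neg (j : ℕ) :
    IntegrableOn (fun x : ℝ => x ^ j * Real.exp (-x)) (Set.Ioi 0) := by
  have := Real.GammaIntegral_convergent (s := (j : ℝ) + 1) (by positivity)
  refine this.congr_fun (fun x hx => ?_) measurableSet_Ioi
  simp only [add_sub_cancel_right, Real.rpow_natCast]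
  ring

lemma integral_pow_mul_exp_neg (j : ℕ) :
    ∫ x in Set.Ioi (0 : ℝ), x ^ j * Real.exp (-x) = (j ! : ℝ) := by
  rw [← Real.Gamma_nat_eq_factorial, Real.Gamma_eq_integral (by positivity)]
  refine setIntegral_congr_fun measurableSet_Ioi fun x hx => ?_
  simp only [add_sub_cancel_right, Real.rpow_natCast]
  ring

lemma integrableOn_eval_mul_exp_neg (p : ℝ[X]) :
    IntegrableOn (fun x : ℝ => p.eval x * Real.exp (-x)) (Set.Ioi 0) := by
  simp_rw [eval_eq_sum_range, Finset.sum_mul, mul_assoc]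
  exact integrable_finsetSum _ fun j _ => (integrableOn_pow_mul_exp_neg j).const_mul _

lemma expFunctional_eq_integral (p : ℝ[X]) :
    expFunctional p = ∫ x in Set.Ioi (0 : ℝ), p.eval x * Real.exp (-x) := by
  simp_rw [eval_eq_sum_range, Finset.sum_mul, mul_assoc]
  rw [integral_finsetSum _ fun j _ => (integrableOn_pow_mul_exp_neg j).const_mul _]
  simp_rw [integral_const_mul, integral_pow_mul_exp_neg]
  conv_lhs => rw [p.as_sum_range]
  rw [map_sum]
  exact Finset.sum_congr rfl fun j _ => by rw [expFunctional_monomial, mul_comm]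

/-- The integrand is nonnegative and vanishes on the half-line only at the finitely many roots of
`p`. -/
lemma expFunctional_pos {p : ℝ[X]} (hp : p ≠ 0) (h0 : ∀ x, 0 ≤ p.eval x) :
    0 < expFunctional p := by
  rw [expFunctional_eq_integral, setIntegral_pos_iff_support_of_nonneg_ae
    (ae_of_all _ fun x => mul_nonneg (h0 x) (Real.exp_pos _).le) (integrableOn_eval_mul_exp_neg p)]
  have hsub : Set.Ioi (0 : ℝ) \ (p.roots.toFinset : Set ℝ) ⊆
      Function.support (fun x : ℝ => p.eval x * Real.exp (-x)) ∩ Set.Ioi 0 := by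
    rintro x ⟨hx, hxp⟩
    refine ⟨mul_ne_zero (fun h => hxp ?_) (Real.exp_pos _).ne', hx⟩
    simpa [hp] using h
  refine lt_of_lt_of_le ?_ (measure_mono hsub)
  rw [measure_sdiff_null (Finset.measure_zero _ _)]
  simp

end Laguerre

/-! ### Gauss-Laguerre nodes, weights and exactness -/

section Quadrature
open Polynomial

lemma mem_nodes {n : ℕ} {τ : ℝ} : τ ∈ nodes n ↔ (laguerre n).eval τ = 0 := by
  simp [nodes, laguerre_ne_zero]

lemma nodes_pos {n : ℕ} {τ : ℝ} (h : τ ∈ nodes n) : 0 < τ := by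
  by_contra! h0
  exact (eval_laguerre_pos h0).ne' (mem_nodes.1 h)

lemma eval_pos_or_neg_of_roots_eq_zero {s : ℝ[X]} (hs : s ≠ 0) (h : s.roots = 0) :
    (∀ x, 0 < s.eval x) ∨ ∀ x, s.eval x < 0 := by
  have hne : ∀ x, s.eval x ≠ 0 := fun x hx => by
    have : x ∈ s.roots := (mem_roots hs).2 hx
    simp [h] at this
  by_contra! hcon
  obtain ⟨⟨x, hx⟩, y, hy⟩ := hcon
  obtain ⟨z, hz⟩ := mem_range_of_exists_le_of_exists_ge (c := (0 : ℝ)) s.continuous ⟨x, hx⟩ ⟨y, hy⟩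
  exact hne z hz

/-- A nonzero real polynomial, multiplied by the linear factors of its roots of odd multiplicity,
does not change sign. -/
lemma eval_mul_prod_odd_roots (p : ℝ[X]) (hp : p ≠ 0) :
    (∀ x, 0 ≤ (p * ∏ r ∈ p.roots.toFinset with Odd (p.roots.count r), (X - C r)).eval x) ∨
      ∀ x, (p * ∏ r ∈ p.roots.toFinset with Odd (p.roots.count r), (X - C r)).eval x ≤ 0 := by
  obtain ⟨s, hs, -, hroots⟩ := p.exists_prod_multiset_X_sub_C_mul
  have hs0 : s ≠ 0 := by rintro rfl; simp at hs; exact hp hs.symm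
  have key : ∀ x, (p * ∏ r ∈ p.roots.toFinset with Odd (p.roots.count r), (X - C r)).eval x =
      (∏ r ∈ p.roots.toFinset,
        (x - r) ^ (p.roots.count r + if Odd (p.roots.count r) then 1 else 0)) * s.eval x := by
    intro x
    conv_lhs => rw [eval_mul]; arg 1; rw [← hs]
    rw [Finset.prod_multiset_map_count, eval_mul, eval_prod, eval_prod, Finset.prod_filter]
    simp_rw [pow_add, Finset.prod_mul_distrib]
    have : ∀ r, (if Odd (p.roots.count r) then (X - C r : ℝ[X]).eval x else 1) =
        (x - r) ^ (if Odd (p.roots.count r) then 1 else 0) := by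
      intro r; split_ifs <;> simp
    simp_rw [this]
    simp only [eval_pow, eval_sub, eval_X, eval_C]
    ring
  have hnn : ∀ x, 0 ≤ ∏ r ∈ p.roots.toFinset,
      (x - r) ^ (p.roots.count r + if Odd (p.roots.count r) then 1 else 0) := by
    intro x
    refine Finset.prod_nonneg fun r _ => Even.pow_nonneg ?_ _
    split_ifs with h
    · exact h.add_one
    · simpa using h
  rcases eval_pos_or_neg_of_roots_eq_zero hs0 hroots with h | h
  · exact Or.inl fun x => by rw [key]; exact mul_nonneg (hnn x) (h x).le
  · exact Or.inr fun x => by rw [key]; exact mul_nonpos_of_nonneg_of_nonpos (hnn x) (h x).le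

/-- Suppose there are fewer than `n` distinct real zeros. The product `q` of the factors `X - r`
over the zeros of odd multiplicity then has degree below `n`, so `q` is orthogonal to `L_n`. But
`L_n q` is nonzero and does not change sign, so the functional cannot vanish on it. -/
lemma card_nodes (n : ℕ) : (nodes n).card = n := by
  have hle : (nodes n).card ≤ n := by
    refine (Multiset.toFinset_card_le _).trans ((card_roots' _).trans (natDegree_laguerre n).le)
  refine le_antisymm hle ?_
  by_contra! hlt
  set q : ℝ[X] := ∏ r ∈ (laguerre n).roots.toFinset with Odd ((laguerre n).roots.count r),
    (X - C r) with hq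
  have hqm : q.Monic := monic_prod_of_monic _ _ fun r _ => monic_X_sub_C r
  have hdeg : q.natDegree < n := by
    rw [hq, natDegree_prod_of_monic _ _ fun r _ => monic_X_sub_C r]
    simp only [natDegree_X_sub_C, Finset.sum_const, smul_eq_mul, mul_one]
    exact (Finset.card_filter_le _ _).trans_lt hlt
  have h0 : expFunctional (laguerre n * q) = 0 := by
    rw [mul_comm, expFunctional_mul_laguerre hdeg.le, coeff_eq_zero_of_natDegree_lt hdeg, zero_mul]
  have hne : laguerre n * q ≠ 0 := mul_ne_zero (laguerre_ne_zero n) hqm.ne_zero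
  rcases eval_mul_prod_odd_roots (laguerre n) (laguerre_ne_zero n) with h | h
  · exact (expFunctional_pos hne h).ne' h0
  · have := expFunctional_pos (neg_ne_zero.2 hne) fun x => by rw [eval_neg]; linarith [h x]
    rw [map_neg, h0, neg_zero] at this
    exact this.false

/-- `L_n(x) / (x - τ)`. -/
def laguerreQuot (n : ℕ) (τ : ℝ) : ℝ[X] := laguerre n /ₘ (X - C τ)

lemma mul_laguerreQuot {n : ℕ} {τ : ℝ} (h : τ ∈ nodes n) :
    (X - C τ) * laguerreQuot n τ = laguerre n :=
  mul_divByMonic_eq_iff_isRoot.2 (mem_nodes.1 h)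

lemma natDegree_laguerreQuot (n : ℕ) (τ : ℝ) : (laguerreQuot n τ).natDegree = n - 1 := by
  rw [laguerreQuot, natDegree_divByMonic _ (monic_X_sub_C τ), natDegree_laguerre, natDegree_X_sub_C]

lemma eval_laguerreQuot_self {n : ℕ} {τ : ℝ} (h : τ ∈ nodes n) :
    (laguerreQuot n τ).eval τ = (laguerre n).derivative.eval τ := by
  conv_rhs => rw [← mul_laguerreQuot h]
  simp [derivative_mul]

lemma eval_laguerreQuot_of_ne {n : ℕ} {τ σ : ℝ} (h : τ ∈ nodes n) (hσ : σ ∈ nodes n)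
    (hne : σ ≠ τ) : (laguerreQuot n τ).eval σ = 0 := by
  have := mem_nodes.1 hσ
  rw [← mul_laguerreQuot h] at this
  simpa [sub_eq_zero, hne] using this

/-- Since `g - g(τ)` is divisible by `X - τ`, its product with `L_n / (X - τ)` is `L_n` times a
polynomial of degree below `n`, and orthogonality removes it. The case of degree exactly `n` is
needed for `g = X L_n'`. -/
lemma expFunctional_laguerreQuot_mul {n : ℕ} {τ : ℝ} (h : τ ∈ nodes n) {g : ℝ[X]}
    (hg : g.natDegree ≤ n) :
    expFunctional (laguerreQuot n τ * g) = g.eval τ * expFunctional (laguerreQuot n τ) := by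
  rcases Nat.eq_zero_or_pos n with rfl | hn
  · have := card_nodes 0
    simp only [Finset.card_eq_zero] at this
    simp [this] at h
  have hr : (X - C τ) * (g /ₘ (X - C τ)) = g - C (g.eval τ) := by
    have := modByMonic_add_div g (X - C τ)
    rw [modByMonic_X_sub_C_eq_C_eval] at this
    rw [eq_sub_iff_add_eq', this]
  have hd : (g /ₘ (X - C τ)).natDegree < n := by
    rw [natDegree_divByMonic _ (monic_X_sub_C τ), natDegree_X_sub_C]; omega
  have h1 : laguerreQuot n τ * g =
      (g /ₘ (X - C τ)) * laguerre n + g.eval τ • laguerreQuot n τ := by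
    rw [smul_eq_C_mul, ← mul_laguerreQuot h]
    linear_combination -laguerreQuot n τ * hr
  rw [h1, map_add, map_smul, expFunctional_mul_laguerre hd.le, coeff_eq_zero_of_natDegree_lt hd]
  simp

/-- Testing the quotient against `X L_n'` produces the left-hand side. By
`X_mul_derivative_laguerre` only the pairing with `L_(n-1)` survives, and it sees just the leading
coefficient of the quotient, which is that of `L_n`. -/
lemma expFunctional_laguerreQuot {n : ℕ} {τ : ℝ} (h : τ ∈ nodes n) :
    τ * (laguerre n).derivative.eval τ * expFunctional (laguerreQuot n τ) = (n ! : ℝ) ^ 2 := by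
  cases n with
  | zero =>
    have := card_nodes 0
    simp only [Finset.card_eq_zero] at this
    simp [this] at h
  | succ n =>
    have hdu : (laguerreQuot (n + 1) τ).natDegree = n := natDegree_laguerreQuot _ _
    have hdg : (X * derivative (laguerre (n + 1))).natDegree ≤ n + 1 := by
      refine natDegree_mul_le.trans ?_
      have := natDegree_derivative_le (laguerre (n + 1))
      rw [natDegree_laguerre] at this
      simp only [natDegree_X]
      omega
    have h1 := expFunctional_laguerreQuot_mul h hdg
    rw [eval_mul, eval_X] at h1
    rw [← h1, X_mul_derivative_laguerre, mul_sub]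
    have e1 : laguerreQuot (n + 1) τ * (C ((n : ℝ) + 1) * laguerre (n + 1)) =
        ((n : ℝ) + 1) • (laguerreQuot (n + 1) τ * laguerre (n + 1)) := by
      rw [smul_eq_C_mul]; ring
    have e2 : laguerreQuot (n + 1) τ * (C (((n : ℝ) + 1) ^ 2) * laguerre n) =
        (((n : ℝ) + 1) ^ 2) • (laguerreQuot (n + 1) τ * laguerre n) := by
      rw [smul_eq_C_mul]; ring
    have hlead : (laguerreQuot (n + 1) τ).coeff n = (-1) ^ (n + 1) := by
      have := congrArg leadingCoeff (mul_laguerreQuot h)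
      rw [leadingCoeff_mul, leadingCoeff_X_sub_C, one_mul, leadingCoeff_laguerre, leadingCoeff,
        hdu] at this
      exact this
    rw [e1, e2, map_sub, map_smul, map_smul, expFunctional_mul_laguerre (by omega),
      expFunctional_mul_laguerre (by omega), coeff_eq_zero_of_natDegree_lt (by omega), hlead,
      Nat.factorial_succ]
    push_cast
    simp only [smul_eq_mul]
    have : (-1 : ℝ) ^ n * (-1) ^ n = 1 := by rw [← mul_pow]; simp
    linear_combination ((n : ℝ) + 1) ^ 2 * (n ! : ℝ) ^ 2 * this

lemma eval_derivative_laguerre_ne_zero {n : ℕ} {τ : ℝ} (h : τ ∈ nodes n) :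
    (laguerre n).derivative.eval τ ≠ 0 := by
  intro h0
  have := expFunctional_laguerreQuot h
  rw [h0, mul_zero, zero_mul] at this
  have h1 : (0 : ℝ) < (n ! : ℝ) ^ 2 := by positivity
  exact h1.ne this

/-- The right-hand side is the functional at the Lagrange basis polynomial of `τ`, so the weights
are those of interpolatory quadrature. -/
lemma weight_eq {n : ℕ} {τ : ℝ} (h : τ ∈ nodes n) :
    weight n τ = expFunctional (laguerreQuot n τ) / (laguerre n).derivative.eval τ := by
  have h1 := eval_derivative_laguerre_ne_zero h
  have h2 := (nodes_pos h).ne'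
  rw [weight, ← expFunctional_laguerreQuot h]
  field_simp

lemma weight_nonneg {n : ℕ} {τ : ℝ} (h : τ ∈ nodes n) : 0 ≤ weight n τ := by
  have := nodes_pos h
  rw [weight]; positivity

lemma sum_weight_mul_eval_of_lt {n : ℕ} {r : ℝ[X]} (hr : r.degree < n) :
    ∑ τ ∈ nodes n, weight n τ * r.eval τ = expFunctional r := by
  have h1 : r = ∑ τ ∈ nodes n, (r.eval τ / (laguerre n).derivative.eval τ) • laguerreQuot n τ := by
    refine eq_of_degrees_lt_of_eval_finset_eq (nodes n) (by rwa [card_nodes]) ?_ ?_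
    · rw [card_nodes]
      refine (degree_sum_le _ _).trans_lt ((Finset.sup_lt_iff ?_).2 fun τ hτ => ?_)
      · exact WithBot.bot_lt_coe _
      · refine (degree_smul_le _ _).trans_lt (degree_le_natDegree.trans_lt ?_)
        rw [natDegree_laguerreQuot]
        have : 0 < n := by
          rw [← card_nodes n]; exact Finset.card_pos.2 ⟨τ, hτ⟩
        exact_mod_cast Nat.sub_lt this one_pos
    · intro σ hσ
      rw [eval_finsetSum, Finset.sum_eq_single σ]
      · rw [eval_smul, eval_laguerreQuot_self hσ, smul_eq_mul,
          div_mul_cancel₀ _ (eval_derivative_laguerre_ne_zero hσ)]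
      · intro τ hτ hne
        rw [eval_smul, eval_laguerreQuot_of_ne hτ hσ hne.symm, smul_zero]
      · exact fun h => absurd hσ h
  conv_rhs => rw [h1, map_sum]
  refine Finset.sum_congr rfl fun τ hτ => ?_
  rw [map_smul, weight_eq hτ, smul_eq_mul]
  ring

/-- Gauss-Laguerre quadrature with `n` nodes is exact in degrees below `2 n`. -/
lemma sum_weight_mul_eval {n : ℕ} {f : ℝ[X]} (hf : f.natDegree < 2 * n) :
    ∑ τ ∈ nodes n, weight n τ * f.eval τ = expFunctional f := by
  have hdm := EuclideanDomain.div_add_mod f (laguerre n)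
  have hr : (f % laguerre n).degree < n := by
    have := degree_mod_lt f (laguerre_ne_zero n)
    rwa [degree_eq_natDegree (laguerre_ne_zero n), natDegree_laguerre] at this
  have hq : (f / laguerre n).natDegree < n := by
    by_contra! hle
    have hn : 0 < n := by omega
    have hq0 : f / laguerre n ≠ 0 := by
      intro h0; rw [h0, natDegree_zero] at hle; omega
    have h1 : (laguerre n * (f / laguerre n)).natDegree = n + (f / laguerre n).natDegree := by
      rw [natDegree_mul (laguerre_ne_zero n) hq0, natDegree_laguerre]
    have h2 : laguerre n * (f / laguerre n) = f - f % laguerre n := eq_sub_of_add_eq hdm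
    have h3 : (f % laguerre n).natDegree < n := by
      rcases eq_or_ne (f % laguerre n) 0 with h0 | h0
      · rw [h0, natDegree_zero]; exact hn
      · exact (natDegree_lt_iff_degree_lt h0).2 hr
    have h4 := natDegree_sub_le f (f % laguerre n)
    rw [← h2, h1] at h4
    omega
  rw [← hdm, map_add, mul_comm, expFunctional_mul_laguerre hq.le,
    coeff_eq_zero_of_natDegree_lt hq, zero_mul, zero_add, ← sum_weight_mul_eval_of_lt hr]
  refine Finset.sum_congr rfl fun τ hτ => ?_
  rw [eval_add, eval_mul, mem_nodes.1 hτ, mul_zero, zero_add]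

lemma sum_weight_mul_pow {n j : ℕ} (hj : j < 2 * n) :
    ∑ τ ∈ nodes n, weight n τ * τ ^ j = (j ! : ℝ) := by
  have := sum_weight_mul_eval (n := n) (f := X ^ j) (by simpa using hj)
  simpa [expFunctional_X_pow] using this

lemma sum_weight {n : ℕ} (hn : 0 < n) : ∑ τ ∈ nodes n, weight n τ = 1 := by
  simpa using sum_weight_mul_pow (n := n) (j := 0) (by omega)

end Quadrature

section

/-! ### Unit rate gamma laws -/

lemma gammaMeasure_one_eq_withDensity (a : ℝ) : gammaMeasure a 1 =
    (volume.restrict (Set.Ioi (0 : ℝ))).withDensity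
      fun x => ENNReal.ofReal (x ^ (a - 1) * Real.exp (-x) / Real.Gamma a) := by
  rw [gammaMeasure, ← withDensity_indicator measurableSet_Ioi]
  refine withDensity_congr_ae ?_
  have h0 : ∀ᵐ x : ℝ, x ≠ 0 := by simp [ae_iff]
  filter_upwards [h0] with x hx
  rcases lt_or_gt_of_ne hx with h | h
  · rw [gammaPDF_of_neg h, Set.indicator_of_notMem (by simpa using h.le)]
  · rw [gammaPDF_of_nonneg h.le, Set.indicator_of_mem (by simpa using h)]
    congr 1
    rw [Real.one_rpow, one_mul]; ring

lemma ae_pos_gammaMeasure_one (a : ℝ) : ∀ᵐ x ∂gammaMeasure a 1, 0 < x := by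
  rw [gammaMeasure_one_eq_withDensity]
  exact (withDensity_absolutelyContinuous _ _).ae_le
    ((ae_restrict_iff' measurableSet_Ioi).2 (ae_of_all _ fun x hx => hx))

lemma measurable_gammaDensity (a : ℝ) : Measurable
    fun x : ℝ => ENNReal.ofReal (x ^ (a - 1) * Real.exp (-x) / Real.Gamma a) := by
  fun_prop

lemma toReal_gammaDensity {a x : ℝ} (ha : 0 < a) (hx : 0 < x) :
    (ENNReal.ofReal (x ^ (a - 1) * Real.exp (-x) / Real.Gamma a)).toReal =
      x ^ (a - 1) * Real.exp (-x) / Real.Gamma a := by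
  have := Real.Gamma_pos_of_pos ha
  exact ENNReal.toReal_ofReal (by positivity)

variable {E : Type*} [NormedAddCommGroup E] [NormedSpace ℝ E]

lemma integral_gammaMeasure_one {a : ℝ} (ha : 0 < a) (f : ℝ → E) : ∫ x, f x ∂gammaMeasure a 1 =
    ∫ x in Set.Ioi (0 : ℝ), (x ^ (a - 1) * Real.exp (-x) / Real.Gamma a) • f x := by
  rw [gammaMeasure_one_eq_withDensity, integral_withDensity_eq_integral_toReal_smul
    (measurable_gammaDensity a) (ae_of_all _ fun _ => ENNReal.ofReal_lt_top)]
  exact setIntegral_congr_fun measurableSet_Ioi fun x hx => by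
    simp only [toReal_gammaDensity ha hx]

lemma integrable_gammaMeasure_one_iff {a : ℝ} (ha : 0 < a) (f : ℝ → E) :
    Integrable f (gammaMeasure a 1) ↔
      IntegrableOn (fun x => (x ^ (a - 1) * Real.exp (-x) / Real.Gamma a) • f x) (Set.Ioi 0) := by
  rw [gammaMeasure_one_eq_withDensity, integrable_withDensity_iff_integrable_smul'
    (measurable_gammaDensity a) (ae_of_all _ fun _ => ENNReal.ofReal_lt_top)]
  exact integrableOn_congr_fun (fun x hx => by simp only [toReal_gammaDensity ha hx])
    measurableSet_Ioi

lemma expMeasure_one : expMeasure 1 = gammaMeasure 1 1 := rfl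

instance : IsProbabilityMeasure (expMeasure 1) := isProbabilityMeasure_expMeasure one_pos

lemma integrable_pow_expMeasure_one (j : ℕ) : Integrable (fun x => x ^ j) (expMeasure 1) := by
  rw [expMeasure_one, integrable_gammaMeasure_one_iff one_pos]
  refine (integrableOn_pow_mul_exp_neg j).congr_fun (fun x hx => ?_) measurableSet_Ioi
  simp [mul_comm]

lemma integral_pow_expMeasure_one (j : ℕ) : ∫ x, x ^ j ∂expMeasure 1 = (j ! : ℝ) := by
  rw [expMeasure_one, integral_gammaMeasure_one one_pos, ← integral_pow_mul_exp_neg]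
  refine setIntegral_congr_fun measurableSet_Ioi fun x hx => ?_
  simp [mul_comm]

/-! ### Convergence of measures from convergence of moments -/

/-- Taylor's formula for `exp (i δ x)`, `x ≥ 0`. -/
lemma norm_exp_sub_taylor_le (δ : ℝ) (m : ℕ) {x : ℝ} (hx : 0 ≤ x) :
    ‖Complex.exp (δ * x * Complex.I) -
      ∑ l ∈ Finset.range m, (δ * Complex.I) ^ l / (l ! : ℂ) * (x : ℂ) ^ l‖ ≤
      |δ| ^ m / (m ! : ℝ) * x ^ m := by
  induction m generalizing x with
  | zero =>
    simp only [Finset.range_zero, Finset.sum_empty, sub_zero]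
    rw [← Complex.ofReal_mul, Complex.norm_exp_ofReal_mul_I]; simp
  | succ m ih =>
    -- The derivative of the remainder of order `m + 1` is `iδ` times the remainder of order `m`, so
    -- the mean value inequality transports the bound from `m` to `m + 1`.
    have hder : ∀ y : ℝ, HasDerivAt (fun y : ℝ => Complex.exp (δ * y * Complex.I) -
        ∑ l ∈ Finset.range (m + 1), (δ * Complex.I) ^ l / (l ! : ℂ) * (y : ℂ) ^ l)
        (δ * Complex.I * (Complex.exp (δ * y * Complex.I) -
          ∑ l ∈ Finset.range m, (δ * Complex.I) ^ l / (l ! : ℂ) * (y : ℂ) ^ l)) y := by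
      intro y
      have hy : HasDerivAt (fun y : ℝ => (y : ℂ)) 1 y := Complex.ofRealCLM.hasDerivAt
      have h1 : HasDerivAt (fun y : ℝ => Complex.exp (δ * y * Complex.I))
          (δ * Complex.I * Complex.exp (δ * y * Complex.I)) y := by
        have := ((hy.const_mul (δ : ℂ)).mul_const Complex.I).cexp
        convert this using 1
        ring
      have h2 : HasDerivAt (fun y : ℝ => ∑ l ∈ Finset.range (m + 1),
          (δ * Complex.I) ^ l / (l ! : ℂ) * (y : ℂ) ^ l)
          (∑ l ∈ Finset.range (m + 1),
            (δ * Complex.I) ^ l / (l ! : ℂ) * (l * (y : ℂ) ^ (l - 1) * 1)) y :=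
        HasDerivAt.fun_sum fun l _ => (hy.pow l).const_mul _
      refine (h1.sub h2).congr_deriv ?_
      rw [mul_sub, Finset.sum_range_succ', Finset.mul_sum]
      congr 1
      simp only [Nat.cast_zero, zero_mul, mul_zero, add_zero]
      refine Finset.sum_congr rfl fun l _ => ?_
      rw [Nat.factorial_succ]
      have : (l ! : ℂ) ≠ 0 := by exact_mod_cast l.factorial_ne_zero
      have : (l : ℂ) + 1 ≠ 0 := by exact_mod_cast l.succ_ne_zero
      push_cast
      field_simp
      ring
    have hB : ∀ y : ℝ, HasDerivAt (fun y : ℝ => |δ| ^ (m + 1) / ((m + 1)! : ℝ) * y ^ (m + 1))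
        (|δ| * (|δ| ^ m / (m ! : ℝ) * y ^ m)) y := by
      intro y
      refine ((hasDerivAt_pow (m + 1) y).const_mul (|δ| ^ (m + 1) / ((m + 1)! : ℝ))).congr_deriv ?_
      rw [Nat.factorial_succ]
      push_cast
      field_simp
      ring
    refine image_norm_le_of_norm_deriv_right_le_deriv_boundary (a := 0) (b := x)
      (fun y _ => (hder y).continuousAt.continuousWithinAt)
      (fun y _ => (hder y).hasDerivWithinAt) ?_ hB (fun y hy => ?_) ⟨hx, le_rfl⟩
    · rw [Finset.sum_range_succ']; simp
    · rw [norm_mul, norm_mul, Complex.norm_real, Complex.norm_I, mul_one, Real.norm_eq_abs]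
      exact mul_le_mul_of_nonneg_left (ih hy.1) (abs_nonneg _)

lemma integrable_ofReal_pow_mul_exp {ν : Measure ℝ} {j : ℕ}
    (hν : Integrable (fun x : ℝ => x ^ j) ν) (t : ℝ) :
    Integrable (fun x : ℝ => (x : ℂ) ^ j * Complex.exp (t * x * Complex.I)) ν := by
  refine hν.norm.mono' (by fun_prop) (ae_of_all _ fun x => ?_)
  rw [norm_mul, ← Complex.ofReal_mul, Complex.norm_exp_ofReal_mul_I, mul_one, norm_pow,
    Complex.norm_real, norm_pow]

/-- Up to the factor `i^j`, the first integral is the `j`-th derivative of the characteristic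
function at `t + δ`, expanded here around `t`. The only moment entering the error bound is that of
order `m + j`, so the bound is the same for all measures sharing it; the ratio `(m+j)!/m!` is
written as `j! C(m+j,j)`. -/
lemma norm_integral_sub_taylor_le {ν : Measure ℝ} (h0 : ∀ᵐ x ∂ν, 0 ≤ x)
    (hν : ∀ j : ℕ, Integrable (fun x : ℝ => x ^ j) ν) (t δ : ℝ) (j m : ℕ)
    (hm : ∫ x, x ^ (m + j) ∂ν = ((m + j)! : ℝ)) :
    ‖∫ x : ℝ, (x : ℂ) ^ j * Complex.exp ((t + δ : ℝ) * x * Complex.I) ∂ν -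
      ∑ l ∈ Finset.range m, (δ * Complex.I) ^ l / (l ! : ℂ) *
        ∫ x : ℝ, (x : ℂ) ^ (l + j) * Complex.exp (t * x * Complex.I) ∂ν‖ ≤
      (j ! : ℝ) * (((m + j).choose j : ℝ) * |δ| ^ m) := by
  simp_rw [← integral_const_mul]
  rw [← integral_finsetSum _ fun l _ =>
      (integrable_ofReal_pow_mul_exp (hν (l + j)) t).const_mul _,
    ← integral_sub (integrable_ofReal_pow_mul_exp (hν j) _) (integrable_finsetSum _ fun l _ =>
      (integrable_ofReal_pow_mul_exp (hν (l + j)) t).const_mul _)]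
  have hrhs : (j ! : ℝ) * (((m + j).choose j : ℝ) * |δ| ^ m) =
      ∫ x, |δ| ^ m / (m ! : ℝ) * x ^ (m + j) ∂ν := by
    rw [integral_const_mul, hm, ← Nat.add_choose_mul_factorial_mul_factorial]
    push_cast
    field_simp
  rw [hrhs]
  refine norm_integral_le_of_norm_le ((hν _).const_mul _) ?_
  filter_upwards [h0] with x hx
  have : (x : ℂ) ^ j * Complex.exp ((t + δ : ℝ) * x * Complex.I) -
      ∑ l ∈ Finset.range m, (δ * Complex.I) ^ l / (l ! : ℂ) *
        ((x : ℂ) ^ (l + j) * Complex.exp (t * x * Complex.I)) =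
      (x : ℂ) ^ j * Complex.exp ((t * x : ℝ) * Complex.I) * (Complex.exp (δ * x * Complex.I) -
        ∑ l ∈ Finset.range m, (δ * Complex.I) ^ l / (l ! : ℂ) * (x : ℂ) ^ l) := by
    rw [mul_sub, Finset.mul_sum]
    congr 1
    · rw [mul_assoc ((x : ℂ) ^ j), ← Complex.exp_add]; congr 2; push_cast; ring
    · refine Finset.sum_congr rfl fun l _ => ?_
      rw [pow_add]; push_cast; ring
  rw [this, norm_mul, norm_mul, Complex.norm_exp_ofReal_mul_I, mul_one, norm_pow, Complex.norm_real,
    Real.norm_of_nonneg hx]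
  refine (mul_le_mul_of_nonneg_left (norm_exp_sub_taylor_le δ m hx) (by positivity)).trans_eq ?_
  rw [pow_add]; ring

/-- If the moments of measures on `[0, ∞)` are eventually those of the unit exponential law, then
the characteristic functions and all their derivatives converge. -/
lemma tendsto_integral_pow_mul_exp {μ : ℕ → Measure ℝ} {ν : Measure ℝ}
    (h0 : ∀ n, ∀ᵐ x ∂μ n, 0 ≤ x) (hμ : ∀ n (j : ℕ), Integrable (fun x : ℝ => x ^ j) (μ n))
    (hm : ∀ j : ℕ, ∀ᶠ n in atTop, ∫ x, x ^ j ∂μ n = (j ! : ℝ))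
    (h0' : ∀ᵐ x ∂ν, 0 ≤ x) (hν : ∀ j : ℕ, Integrable (fun x : ℝ => x ^ j) ν)
    (hm' : ∀ j : ℕ, ∫ x, x ^ j ∂ν = (j ! : ℝ)) (N : ℕ) (t : ℝ) (ht : |t| ≤ N / 2) (j : ℕ) :
    Tendsto (fun n => ∫ x : ℝ, (x : ℂ) ^ j * Complex.exp (t * x * Complex.I) ∂μ n) atTop
      (𝓝 (∫ x : ℝ, (x : ℂ) ^ j * Complex.exp (t * x * Complex.I) ∂ν)) := by
  induction N generalizing t j with
  | zero =>
    have : t = 0 := by simpa using ht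
    subst this
    simp only [Complex.ofReal_zero, zero_mul, Complex.exp_zero, mul_one, ← Complex.ofReal_pow,
      integral_complex_ofReal]
    rw [hm' j]
    exact tendsto_const_nhds.congr' ((hm j).mono fun n hn => by simp only [hn])
  | succ N ih =>
    -- A step with `|δ| ≤ 1/2` makes the error bound `j! C(m+j,j) |δ|^m` tend to `0` in `m`. First
    -- `m` is fixed, then `n` is taken large. All `j` are carried through the induction because the
    -- expansion at `s` involves the derivatives of order `l + j`.
    obtain ⟨s, δ, rfl, hs, hδ⟩ : ∃ s δ : ℝ, t = s + δ ∧ |s| ≤ N / 2 ∧ |δ| ≤ 1 / 2 := by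
      have hN : (0 : ℝ) ≤ N := Nat.cast_nonneg N
      push_cast at ht
      rw [abs_le] at ht
      rcases lt_or_ge t (-(N / 2)) with h | h
      · exact ⟨-(N / 2), t + N / 2, by ring, by rw [abs_neg, abs_of_nonneg (by positivity)],
          by rw [abs_le]; constructor <;> linarith⟩
      rcases lt_or_ge ((N : ℝ) / 2) t with h' | h'
      · exact ⟨N / 2, t - N / 2, by ring, by rw [abs_of_nonneg (by positivity)],
          by rw [abs_le]; constructor <;> linarith⟩
      · exact ⟨t, 0, by ring, by rw [abs_le]; constructor <;> linarith, by norm_num⟩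
    have hε : Tendsto (fun m : ℕ => (j ! : ℝ) * (((m + j).choose j : ℝ) * |δ| ^ m)) atTop (𝓝 0) := by
      have := (summable_choose_mul_geometric_of_norm_lt_one (R := ℝ) j (r := |δ|)
        (by rw [Real.norm_eq_abs, abs_abs]; exact hδ.trans_lt (by norm_num))).tendsto_atTop_zero
      simpa using this.const_mul (j ! : ℝ)
    rw [Metric.tendsto_atTop']
    intro ε hε0
    obtain ⟨m, hmε⟩ := ((tendsto_order.1 hε).2 (ε / 3) (by positivity)).exists
    have hb : Tendsto (fun n => ∑ l ∈ Finset.range m, (δ * Complex.I) ^ l / (l ! : ℂ) *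
        ∫ x : ℝ, (x : ℂ) ^ (l + j) * Complex.exp (s * x * Complex.I) ∂μ n) atTop
        (𝓝 (∑ l ∈ Finset.range m, (δ * Complex.I) ^ l / (l ! : ℂ) *
        ∫ x : ℝ, (x : ℂ) ^ (l + j) * Complex.exp (s * x * Complex.I) ∂ν)) :=
      tendsto_finsetSum _ fun l _ => (ih s hs (l + j)).const_mul _
    have hev := (hm (m + j)).and ((Metric.tendsto_nhds.1 hb) (ε / 3) (by positivity))
    obtain ⟨n₀, hn₀⟩ := eventually_atTop.1 hev
    refine ⟨n₀, fun n hn => ?_⟩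
    obtain ⟨h1, h2⟩ := hn₀ n hn.le
    have e1 := norm_integral_sub_taylor_le (h0 n) (hμ n) s δ j m h1
    have e2 := norm_integral_sub_taylor_le h0' hν s δ j m (hm' _)
    rw [← dist_eq_norm] at e1 e2
    rw [dist_comm] at e2
    exact (dist_triangle4 _ (∑ l ∈ Finset.range m, (δ * Complex.I) ^ l / (l ! : ℂ) *
        ∫ x : ℝ, (x : ℂ) ^ (l + j) * Complex.exp (s * x * Complex.I) ∂μ n) _ _).trans_lt
      ((add_lt_add (add_lt_add (e1.trans_lt hmε) h2) (e2.trans_lt hmε)).trans_eq (add_thirds ε))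

/-! ### The quadrature measures -/

/-- The discrete measure with the Gauss-Laguerre weights at the Gauss-Laguerre nodes. -/
def quadMeasure (n : ℕ) : Measure ℝ :=
  ∑ τ ∈ nodes n, ENNReal.ofReal (weight n τ) • Measure.dirac τ

lemma integrable_quadMeasure {E : Type*} [NormedAddCommGroup E] (n : ℕ) (f : ℝ → E) : Integrable f (quadMeasure n) :=
  integrable_finsetSum_measure.2 fun _ _ =>
    (integrable_dirac (by simp)).smul_measure ENNReal.ofReal_ne_top

lemma integral_quadMeasure [CompleteSpace E] (n : ℕ) (f : ℝ → E) :
    ∫ x, f x ∂quadMeasure n = ∑ τ ∈ nodes n, weight n τ • f τ := by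
  rw [quadMeasure, integral_finsetSum_measure fun _ _ =>
    (integrable_dirac (by simp)).smul_measure ENNReal.ofReal_ne_top]
  refine Finset.sum_congr rfl fun τ hτ => ?_
  rw [integral_smul_measure, integral_dirac, ENNReal.toReal_ofReal (weight_nonneg hτ)]

lemma isProbabilityMeasure_quadMeasure {n : ℕ} (hn : 0 < n) :
    IsProbabilityMeasure (quadMeasure n) := by
  refine ⟨?_⟩
  rw [quadMeasure, Measure.finsetSum_apply]
  simp only [Measure.smul_apply, measure_univ, smul_eq_mul, mul_one]
  rw [← ENNReal.ofReal_sum_of_nonneg fun τ hτ => weight_nonneg hτ, sum_weight hn,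
    ENNReal.ofReal_one]

lemma ae_nonneg_quadMeasure (n : ℕ) : ∀ᵐ x ∂quadMeasure n, 0 ≤ x := by
  rw [ae_iff, quadMeasure, Measure.finsetSum_apply]
  refine Finset.sum_eq_zero fun τ hτ => ?_
  rw [Measure.smul_apply, Measure.dirac_apply, Set.indicator_of_notMem, smul_zero]
  simpa using (nodes_pos hτ).le

/-- The quadrature measure of order `n + 1` as a probability measure. -/
def quadProbability (n : ℕ) : ProbabilityMeasure ℝ :=
  ⟨quadMeasure (n + 1), isProbabilityMeasure_quadMeasure n.succ_pos⟩

lemma tendsto_quadProbability :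
    Tendsto quadProbability atTop (𝓝 ⟨expMeasure 1, inferInstance⟩) := by
  refine ProbabilityMeasure.tendsto_iff_tendsto_charFun.2 fun t => ?_
  simp only [charFun_apply_real, quadProbability, ProbabilityMeasure.coe_mk]
  obtain ⟨N, hN⟩ := exists_nat_ge (|t| * 2)
  have := tendsto_integral_pow_mul_exp (μ := fun n => quadMeasure (n + 1)) (ν := expMeasure 1)
    (fun n => ae_nonneg_quadMeasure _) (fun n j => integrable_quadMeasure _ _)
    (fun j => ?_) ((ae_pos_gammaMeasure_one 1).mono fun x hx => hx.le)
    integrable_pow_expMeasure_one integral_pow_expMeasure_one N t (by linarith) 0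
  · simpa using this
  · filter_upwards [eventually_ge_atTop j] with n hn
    rw [integral_quadMeasure]
    exact sum_weight_mul_pow (by omega)

/-- The product Gauss-Laguerre rule converges for bounded continuous functions. -/
theorem tendsto_sum_sum_weight_mul (f : BoundedContinuousFunction (ℝ × ℝ) ℝ) :
    Tendsto (fun SD : ℕ × ℕ => ∑ τs ∈ nodes SD.1, ∑ τd ∈ nodes SD.2,
      weight SD.1 τs * weight SD.2 τd * f (τs, τd)) (atTop ×ˢ atTop)
      (𝓝 (∫ q, f q ∂((expMeasure 1).prod (expMeasure 1)))) := by
  have h1 : Tendsto (fun SD : ℕ × ℕ => (quadProbability SD.1).prod (quadProbability SD.2))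
      (atTop ×ˢ atTop) (𝓝 (ProbabilityMeasure.prod ⟨expMeasure 1, inferInstance⟩
        ⟨expMeasure 1, inferInstance⟩)) :=
    (ProbabilityMeasure.continuous_prod.tendsto (_, _)).comp
      ((tendsto_quadProbability.comp tendsto_fst).prodMk_nhds
        (tendsto_quadProbability.comp tendsto_snd))
  have h2 := ProbabilityMeasure.tendsto_iff_forall_integral_tendsto.1 h1 f
  have h3 : ∀ SD : ℕ × ℕ, ∫ q, f q ∂((quadProbability SD.1).prod (quadProbability SD.2) :
      ProbabilityMeasure (ℝ × ℝ)).toMeasure = ∑ τs ∈ nodes (SD.1 + 1), ∑ τd ∈ nodes (SD.2 + 1),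
      weight (SD.1 + 1) τs * weight (SD.2 + 1) τd * f (τs, τd) := by
    intro SD
    rw [ProbabilityMeasure.prod, ProbabilityMeasure.coe_mk, integral_prod _ (f.integrable _)]
    simp only [quadProbability, ProbabilityMeasure.coe_mk, integral_quadMeasure, smul_eq_mul,
      Finset.mul_sum, mul_assoc]
  simp_rw [h3] at h2
  -- Order `0` has no nodes, so `quadProbability` is indexed from order `1`; the shift is undone
  -- here.
  have hsub : Tendsto (fun SD : ℕ × ℕ => (SD.1 - 1, SD.2 - 1)) (atTop ×ˢ atTop)
      (atTop ×ˢ atTop) :=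
    ((tendsto_sub_atTop_nat 1).comp tendsto_fst).prodMk ((tendsto_sub_atTop_nat 1).comp tendsto_snd)
  refine (h2.comp hsub).congr' ?_
  filter_upwards [((eventually_ge_atTop 1).prod_mk (eventually_ge_atTop 1))] with SD hSD
  simp only [Function.comp, Nat.sub_add_cancel hSD.1, Nat.sub_add_cancel hSD.2]

end

/-! ### Order statistics -/

lemma kthSmallest_lt_iff {K k : ℕ} (hk : 1 ≤ k) (hkK : k ≤ K) (g : Fin K → ℝ) (x : ℝ) :
    kthSmallest g k < x ↔ k ≤ (Finset.univ.filter fun j => g j < x).card := by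
  have : Nonempty (Fin K) := ⟨⟨0, by omega⟩⟩
  -- `k ≤ K` makes the set nonempty and `1 ≤ k` makes it bounded below; without these `sInf` would
  -- take its default value `0`.
  have hne : {x : ℝ | k ≤ (Finset.univ.filter fun j => g j ≤ x).card}.Nonempty := by
    refine ⟨Finset.univ.sup' Finset.univ_nonempty g, ?_⟩
    have : (Finset.univ.filter fun j => g j ≤ Finset.univ.sup' Finset.univ_nonempty g) =
        Finset.univ := Finset.filter_true_of_mem fun j hj => Finset.le_sup' g hj
    rw [Set.mem_ofPred_eq, this, Finset.card_univ, Fintype.card_fin]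
    exact hkK
  have hbdd : BddBelow {x : ℝ | k ≤ (Finset.univ.filter fun j => g j ≤ x).card} := by
    refine ⟨Finset.univ.inf' Finset.univ_nonempty g, fun y hy => ?_⟩
    obtain ⟨j, hj⟩ := Finset.card_pos.1 (hk.trans hy)
    exact (Finset.inf'_le g (Finset.mem_univ j)).trans (Finset.mem_filter.1 hj).2
  constructor
  · intro h
    obtain ⟨y, hy, hyx⟩ := exists_lt_of_csInf_lt hne h
    exact hy.trans (Finset.card_le_card
      (Finset.monotone_filter_right _ fun j _ hj => lt_of_le_of_lt hj hyx))
  · intro h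
    have hF : (Finset.univ.filter fun j => g j < x).Nonempty := Finset.card_pos.1 (hk.trans h)
    -- The largest of the entries below `x` belongs to the set and is still smaller than `x`, so the
    -- strict inequality survives the infimum.
    refine lt_of_le_of_lt (csInf_le hbdd (h.trans (Finset.card_le_card fun j hj => ?_)))
      ((Finset.sup'_lt_iff hF (f := g)).2 fun j hj => (Finset.mem_filter.1 hj).2)
    exact Finset.mem_filter.2 ⟨Finset.mem_univ j, Finset.le_sup' g hj⟩

lemma measurable_kthSmallest {K k : ℕ} (hk : 1 ≤ k) (hkK : k ≤ K) :
    Measurable fun g : Fin K → ℝ => kthSmallest g k := by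
  refine measurable_of_Iio fun x => ?_
  have : (fun g : Fin K → ℝ => kthSmallest g k) ⁻¹' Set.Iio x =
      {g | k ≤ ∑ j : Fin K, if g j < x then 1 else 0} := by
    ext g
    simp only [Set.mem_preimage, Set.mem_Iio, kthSmallest_lt_iff hk hkK, Finset.card_filter,
      Set.mem_ofPred_eq]
  rw [this]
  refine measurableSet_le measurable_const (Finset.measurable_fun_sum _ fun j _ => ?_)
  exact Measurable.ite (measurableSet_lt (measurable_pi_apply j) measurable_const)
    measurable_const measurable_const

/-- The event is a box whose sides are `Iio x` for the indices in `s` and its complement for the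
others. -/
lemma pi_filter_lt_eq {K : ℕ} (L : Measure ℝ) [IsProbabilityMeasure L] (x : ℝ)
    (s : Finset (Fin K)) :
    (Measure.pi fun _ : Fin K => L).real {g | (Finset.univ.filter fun j => g j < x) = s} =
      L.real (Set.Iio x) ^ s.card * (1 - L.real (Set.Iio x)) ^ (K - s.card) := by
  have hset : {g : Fin K → ℝ | (Finset.univ.filter fun j => g j < x) = s} =
      Set.univ.pi fun j => if j ∈ s then Set.Iio x else (Set.Iio x)ᶜ := by
    ext g
    simp only [Set.mem_ofPred_eq, Set.mem_pi, Set.mem_univ, true_implies, Finset.ext_iff,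
      Finset.mem_filter, Finset.mem_univ, true_and]
    refine forall_congr' fun j => ?_
    split_ifs with h <;> simp [h]
  rw [hset, measureReal_def, Measure.pi_pi, ENNReal.toReal_prod]
  have : ∀ j : Fin K, (L (if j ∈ s then Set.Iio x else (Set.Iio x)ᶜ)).toReal =
      if j ∈ s then L.real (Set.Iio x) else 1 - L.real (Set.Iio x) := by
    intro j
    split_ifs
    · rfl
    · exact probReal_compl_eq_one_sub measurableSet_Iio
  simp_rw [this]
  rw [Finset.prod_ite, Finset.prod_const, Finset.prod_const]
  congr 2
  · simp
  · rw [Finset.filter_not, Finset.card_sdiff]; simp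

open Polynomial in
/-- The upper tail of the binomial law as a polynomial in the success probability. -/
lemma sum_Icc_bernstein {K k : ℕ} (hk : 1 ≤ k) (hkK : k ≤ K) (F : ℝ) :
    ∑ i ∈ Finset.Icc k K, (K.choose i : ℝ) * (F ^ i * (1 - F) ^ (K - i)) =
      (K ! : ℝ) / (((K - k)! : ℝ) * ((k - 1)! : ℝ)) *
        ∑ l ∈ Finset.range (K - k + 1),
          ((K - k).choose l : ℝ) * ((-1) ^ l / ((k : ℝ) + l)) * F ^ (k + l) := by
  obtain ⟨k, rfl⟩ := Nat.exists_eq_add_of_le' hk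
  obtain ⟨m, rfl⟩ := Nat.exists_eq_add_of_le' hkK
  set p : ℝ[X] := ∑ i ∈ Finset.Icc (k + 1) (m + (k + 1)), bernsteinPolynomial ℝ (m + (k + 1)) i
  set c : ℝ := ((m + (k + 1))! : ℝ) / ((m ! : ℝ) * (k ! : ℝ)) with hc
  set q : ℝ[X] := C c * ∑ l ∈ Finset.range (m + 1),
      C ((m.choose l : ℝ) * ((-1) ^ l / ((k : ℝ) + 1 + l))) * X ^ (k + 1 + l)
  have hp : p.eval F = ∑ i ∈ Finset.Icc (k + 1) (m + (k + 1)),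
      ((m + (k + 1)).choose i : ℝ) * (F ^ i * (1 - F) ^ (m + (k + 1) - i)) := by
    simp only [p, eval_finsetSum, bernsteinPolynomial]
    simp [mul_assoc]
  have hq : q.eval F = c * ∑ l ∈ Finset.range (m + 1),
      (m.choose l : ℝ) * ((-1) ^ l / ((k : ℝ) + 1 + l)) * F ^ (k + 1 + l) := by
    simp [q, eval_finsetSum]
  -- The shifted parameters are `k + 1` and `K = m + k + 1`. Both polynomials vanish at `0` and have
  -- derivative `c X^k (1 - X)^m`: on the left the derivatives of the Bernstein polynomials
  -- telescope, on the right this is the binomial theorem.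
  suffices h : p = q by
    rw [← hp, h, hq, hc]
    simp
  have hdp : derivative p = C c * (X ^ k * (1 - X) ^ m) := by
    have htel : ∀ i ∈ Finset.range (m + 1),
        derivative (bernsteinPolynomial ℝ (m + (k + 1)) (i + (k + 1))) =
        ((m + k + 1 : ℕ) : ℝ[X]) * (bernsteinPolynomial ℝ (m + k) (i + k) -
          bernsteinPolynomial ℝ (m + k) (i + 1 + k)) := by
      intro i _
      rw [show m + (k + 1) = m + k + 1 by ring, show i + (k + 1) = i + k + 1 by ring,
        show i + 1 + k = i + k + 1 by ring, bernsteinPolynomial.derivative_succ_aux]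
      push_cast; rfl
    have hI : Finset.Icc (k + 1) (m + (k + 1)) =
        (Finset.range (m + 1)).map (addRightEmbedding (k + 1)) := by
      ext i
      simp only [Finset.mem_Icc, Finset.mem_map, Finset.mem_range, addRightEmbedding_apply]
      constructor
      · rintro ⟨h1, h2⟩; exact ⟨i - (k + 1), by omega, by omega⟩
      · rintro ⟨j, hj, rfl⟩; omega
    simp only [p, hI, Finset.sum_map, addRightEmbedding_apply, derivative_sum]
    rw [Finset.sum_congr rfl htel, ← Finset.mul_sum, Finset.sum_range_sub',
      bernsteinPolynomial.eq_zero_of_lt ℝ (show m + k < m + 1 + k by omega), sub_zero, zero_add,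
      bernsteinPolynomial, Nat.add_sub_cancel]
    have : (((m + k + 1 : ℕ) : ℝ[X]) * ((m + k).choose k : ℝ[X])) = C c := by
      rw [← Nat.cast_mul, ← C_eq_natCast]
      congr 1
      rw [hc, eq_div_iff (by positivity), show m + (k + 1) = m + k + 1 by ring, Nat.factorial_succ,
        ← Nat.add_choose_mul_factorial_mul_factorial m k]
      push_cast; ring
    rw [← this]; ring
  have hdq : derivative q = C c * (X ^ k * (1 - X) ^ m) := by
    have hX : (1 - X : ℝ[X]) ^ m = ∑ l ∈ Finset.range (m + 1),
        C ((m.choose l : ℝ) * (-1) ^ l) * X ^ l := by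
      rw [show (1 - X : ℝ[X]) = -X + 1 by ring, add_pow]
      refine Finset.sum_congr rfl fun l _ => ?_
      rw [neg_pow]; simp; ring
    simp only [q, derivative_C_mul, derivative_sum, hX]
    congr 1
    rw [Finset.mul_sum]
    refine Finset.sum_congr rfl fun l _ => ?_
    rw [derivative_X_pow, show k + 1 + l - 1 = k + l by omega, pow_add]
    have : ((k : ℝ) + 1 + l) ≠ 0 := by positivity
    have h2 : (m.choose l : ℝ) * (-1) ^ l =
        (m.choose l : ℝ) * ((-1) ^ l / ((k : ℝ) + 1 + l)) * ((k + 1 + l : ℕ) : ℝ) := by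
      push_cast; field_simp
    rw [h2]
    generalize (m.choose l : ℝ) * ((-1) ^ l / ((k : ℝ) + 1 + l)) = b
    rw [C_mul]
    ring
  have h0 : p.coeff 0 = q.coeff 0 := by
    have hp0 : p.coeff 0 = 0 := by
      simp only [p, finsetSum_coeff]
      refine Finset.sum_eq_zero fun i hi => ?_
      rw [coeff_zero_eq_eval_zero, bernsteinPolynomial.eval_at_0, if_neg]
      have := (Finset.mem_Icc.1 hi).1
      omega
    have hq0 : q.coeff 0 = 0 := by
      rw [coeff_zero_eq_eval_zero]
      simp [q, eval_finsetSum]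
    rw [hp0, hq0]
  have hd : derivative (p - q) = 0 := by rw [derivative_sub, hdp, hdq, sub_self]
  have := derivative_eq_zero.1 hd
  rw [← sub_eq_zero, eq_C_of_natDegree_eq_zero this, coeff_sub, h0, sub_self, C_0]

/-- The distribution function of the `k`-th order statistic. -/
lemma orderStatLaw_Iio {K k : ℕ} (hk : 1 ≤ k) (hkK : k ≤ K) (L : Measure ℝ)
    [IsProbabilityMeasure L] (x : ℝ) :
    (orderStatLaw K k L).real (Set.Iio x) =
      (K ! : ℝ) / (((K - k)! : ℝ) * ((k - 1)! : ℝ)) *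
        ∑ l ∈ Finset.range (K - k + 1),
          ((K - k).choose l : ℝ) * ((-1) ^ l / ((k : ℝ) + l)) * L.real (Set.Iio x) ^ (k + l) := by
  rw [orderStatLaw, map_measureReal_apply (measurable_kthSmallest hk hkK) measurableSet_Iio,
    ← sum_Icc_bernstein hk hkK]
  -- The event is split according to the exact set of indices whose entries lie below `x`; the
  -- pieces are then grouped by cardinality.
  have hset : (fun g : Fin K → ℝ => kthSmallest g k) ⁻¹' Set.Iio x =
      ⋃ s ∈ Finset.univ.filter fun s : Finset (Fin K) => k ≤ s.card,
        {g | (Finset.univ.filter fun j => g j < x) = s} := by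
    ext g
    simp [kthSmallest_lt_iff hk hkK]
  have hmeas : ∀ s : Finset (Fin K),
      MeasurableSet {g : Fin K → ℝ | (Finset.univ.filter fun j => g j < x) = s} := by
    intro s
    have : {g : Fin K → ℝ | (Finset.univ.filter fun j => g j < x) = s} =
        ⋂ j, {g | g j < x ↔ j ∈ s} := by
      ext g; simp [Finset.ext_iff]
    rw [this]
    refine MeasurableSet.iInter fun j => ?_
    by_cases h : j ∈ s
    · simpa [h] using measurableSet_lt (measurable_pi_apply j) measurable_const
    · simpa [h] using measurableSet_le measurable_const (measurable_pi_apply j)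
  rw [hset, measureReal_biUnion_finset (fun s _ t _ hst => ?_) fun s _ => hmeas s]
  · simp_rw [pi_filter_lt_eq]
    have : ∀ i ∈ Finset.Icc k K, (K.choose i : ℝ) *
        (L.real (Set.Iio x) ^ i * (1 - L.real (Set.Iio x)) ^ (K - i)) =
        ∑ s ∈ Finset.powersetCard i (Finset.univ : Finset (Fin K)),
          L.real (Set.Iio x) ^ s.card * (1 - L.real (Set.Iio x)) ^ (K - s.card) := by
      intro i _
      rw [Finset.sum_congr rfl fun s hs => by rw [(Finset.mem_powersetCard.1 hs).2]]
      simp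
    rw [Finset.sum_congr rfl this, Finset.sum_sigma']
    refine Finset.sum_bij' (fun s _ => (⟨s.card, s⟩ : (_ : ℕ) × Finset (Fin K)))
      (fun s _ => s.2) ?_ ?_ ?_ ?_ ?_
    · intro s hs
      simp only [Finset.mem_filter, Finset.mem_univ, true_and] at hs
      simp only [Finset.mem_sigma, Finset.mem_Icc, Finset.mem_powersetCard_univ, and_true]
      exact ⟨hs, by simpa using Finset.card_le_univ s⟩
    · rintro ⟨i, s⟩ hs
      simp only [Finset.mem_sigma, Finset.mem_Icc, Finset.mem_powersetCard_univ] at hs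
      simp [hs.2, hs.1.1]
    · intro s _; rfl
    · rintro ⟨i, s⟩ hs
      simp only [Finset.mem_sigma, Finset.mem_Icc, Finset.mem_powersetCard_univ] at hs
      obtain ⟨-, rfl⟩ := hs
      rfl
    · intro s _; rfl
  · refine Set.disjoint_left.2 fun g hg hg' => hst ?_
    exact hg.symm.trans hg'

/-! ### Characteristic functions of the unit rate gamma laws -/

lemma one_sub_mul_I_ne_zero (t : ℝ) : (1 - t * Complex.I : ℂ) ≠ 0 := by
  intro h
  have := congrArg Complex.re h
  simp at this

lemma norm_pow_mul_cexp {x : ℝ} (hx : 0 ≤ x) (t : ℝ) (n : ℕ) :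
    ‖(x : ℂ) ^ n * Complex.exp (-(1 - t * Complex.I) * x)‖ = x ^ n * Real.exp (-x) := by
  rw [norm_mul, norm_pow, Complex.norm_real, Complex.norm_exp, Real.norm_of_nonneg hx]
  simp

lemma integrableOn_pow_mul_cexp (t : ℝ) (n : ℕ) :
    IntegrableOn (fun x : ℝ => (x : ℂ) ^ n * Complex.exp (-(1 - t * Complex.I) * x))
      (Set.Ioi 0) :=
  (integrableOn_pow_mul_exp_neg n).mono' (by fun_prop)
    ((ae_restrict_iff' measurableSet_Ioi).2
      (ae_of_all _ fun x hx => (norm_pow_mul_cexp (le_of_lt hx) t n).le))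

lemma integral_pow_mul_cexp (t : ℝ) (n : ℕ) :
    ∫ x in Set.Ioi (0 : ℝ), (x : ℂ) ^ n * Complex.exp (-(1 - t * Complex.I) * x) =
      (n ! : ℂ) / (1 - t * Complex.I) ^ (n + 1) := by
  have hc := one_sub_mul_I_ne_zero t
  induction n with
  | zero =>
    simp only [pow_zero, one_mul]
    rw [integral_exp_mul_complex_Ioi (by simp)]
    simp only [Complex.ofReal_zero, mul_zero, Complex.exp_zero, Nat.factorial_zero, Nat.cast_one,
      zero_add, pow_one, neg_div_neg_eq]
  | succ n ih =>
    have hder : ∀ x ∈ Set.Ici (0 : ℝ), HasDerivAt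
        (fun x : ℝ => (x : ℂ) ^ (n + 1) * Complex.exp (-(1 - t * Complex.I) * x))
        (((n + 1 : ℕ) : ℂ) * ((x : ℂ) ^ n * Complex.exp (-(1 - t * Complex.I) * x)) -
          (1 - t * Complex.I) * ((x : ℂ) ^ (n + 1) * Complex.exp (-(1 - t * Complex.I) * x)))
        x := by
      intro x _
      have hx : HasDerivAt (fun y : ℝ => (y : ℂ)) 1 x := Complex.ofRealCLM.hasDerivAt
      refine ((hx.pow (n + 1)).mul ((hx.const_mul (-(1 - t * Complex.I) : ℂ)).cexp)).congr_deriv ?_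
      simp only [Nat.add_sub_cancel, Pi.pow_apply]
      ring
    have hi1 := (integrableOn_pow_mul_cexp t n).const_mul ((n + 1 : ℕ) : ℂ)
    have hi2 := (integrableOn_pow_mul_cexp t (n + 1)).const_mul (1 - t * Complex.I : ℂ)
    have hlim : Tendsto (fun x : ℝ => (x : ℂ) ^ (n + 1) *
        Complex.exp (-(1 - t * Complex.I) * x)) atTop (𝓝 0) := by
      rw [tendsto_zero_iff_norm_tendsto_zero]
      refine (Real.tendsto_pow_mul_exp_neg_atTop_nhds_zero (n + 1)).congr' ?_
      filter_upwards [eventually_ge_atTop 0] with x hx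
      exact (norm_pow_mul_cexp hx t _).symm
    have := integral_Ioi_of_hasDerivAt_of_tendsto' hder (hi1.sub hi2) hlim
    rw [integral_sub hi1 hi2, integral_const_mul, integral_const_mul, ih] at this
    simp only [Complex.ofReal_zero, zero_pow n.succ_ne_zero, zero_mul, sub_zero] at this
    rw [sub_eq_zero] at this
    rw [Nat.factorial_succ, eq_div_iff (pow_ne_zero _ hc), pow_succ, mul_comm, mul_assoc, ← this]
    push_cast
    field_simp

lemma charFun_gammaMeasure_one (n : ℕ) (t : ℝ) :
    charFun (gammaMeasure ((n + 1 : ℕ) : ℝ) 1) t = 1 / (1 - t * Complex.I) ^ (n + 1) := by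
  rw [charFun_apply_real, integral_gammaMeasure_one (by positivity)]
  have h : ∀ x ∈ Set.Ioi (0 : ℝ), (x ^ (((n + 1 : ℕ) : ℝ) - 1) * Real.exp (-x) /
      Real.Gamma ((n + 1 : ℕ) : ℝ)) • Complex.exp (t * x * Complex.I) =
      (1 / (n ! : ℂ)) * ((x : ℂ) ^ n * Complex.exp (-(1 - t * Complex.I) * x)) := by
    intro x _
    have h1 : Complex.exp (-(1 - t * Complex.I) * x) =
        Complex.exp (-x) * Complex.exp (t * x * Complex.I) := by
      rw [← Complex.exp_add]; congr 1; ring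
    rw [Nat.cast_add_one, Real.Gamma_nat_eq_factorial, add_sub_cancel_right, Real.rpow_natCast,
      Complex.real_smul, h1]
    push_cast
    ring
  rw [setIntegral_congr_fun measurableSet_Ioi h, integral_const_mul, integral_pow_mul_cexp]
  have : (n ! : ℂ) ≠ 0 := by exact_mod_cast n.factorial_ne_zero
  field_simp

lemma gammaMeasure_one_Iio {x : ℝ} (hx : 0 ≤ x) :
    (gammaMeasure 1 1).real (Set.Iio x) = 1 - Real.exp (-x) := by
  have h := cdf_expMeasure_eq one_pos x
  rw [if_pos hx, one_mul, cdf_eq_real, expMeasure_one] at h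
  rw [← h]
  refine measureReal_congr (Iio_ae_eq_Iic' ?_)
  rw [gammaMeasure]
  exact withDensity_absolutelyContinuous _ _ (by simp)

lemma integral_id_gammaMeasure_one {a : ℝ} (ha : 0 < a) :
    Integrable (fun x => x) (gammaMeasure a 1) ∧ ∫ x, x ∂gammaMeasure a 1 = a := by
  have hG := (Real.Gamma_pos_of_pos ha).ne'
  have h : ∀ x ∈ Set.Ioi (0 : ℝ), (x ^ (a - 1) * Real.exp (-x) / Real.Gamma a) • x =
      (1 / Real.Gamma a) * (Real.exp (-x) * x ^ (a + 1 - 1)) := by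
    intro x hx
    rw [show a + 1 - 1 = (a - 1) + 1 by ring, Real.rpow_add_one (ne_of_gt hx), smul_eq_mul]
    ring
  constructor
  · rw [integrable_gammaMeasure_one_iff ha]
    exact IntegrableOn.congr_fun
      ((Real.GammaIntegral_convergent (s := a + 1) (by linarith)).const_mul _)
      (fun x hx => (h x hx).symm) measurableSet_Ioi
  · rw [integral_gammaMeasure_one ha, setIntegral_congr_fun measurableSet_Ioi h, integral_const_mul,
      ← Real.Gamma_eq_integral (by linarith), Real.Gamma_add_one ha.ne']
    field_simp

/-! ### The integral representation of the Bessel function -/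

/-- The substitution `s = √z eᵗ` turns `s + z/s` into `2 √z cosh t` and `s^(a-1) ds` into `z^(a/2)
e^(a t) dt`. Symmetrising in `t` replaces `e^(a t)` by `cosh (a t)` and folds the line onto the
half-line. -/
lemma integral_exp_neg_div_gammaMeasure_one {a z : ℝ} (ha : 0 < a) (hz : 0 < z) :
    ∫ s, Real.exp (-(z / s)) ∂gammaMeasure a 1 =
      2 / Real.Gamma a * z ^ (a / 2) * besselK a (2 * √z) := by
  have hG := (Real.Gamma_pos_of_pos ha).ne'
  have hsz : 0 < √z := Real.sqrt_pos.2 hz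
  set g : ℝ → ℝ := fun s => s ^ (a - 1) * Real.exp (-s) * Real.exp (-(z / s)) with hg
  have hgi : IntegrableOn g (Set.Ioi 0) := by
    refine (Real.GammaIntegral_convergent ha).mono' (by fun_prop)
      ((ae_restrict_iff' measurableSet_Ioi).2 (ae_of_all _ fun s hs => ?_))
    have hs' : 0 < s := hs
    rw [Real.norm_of_nonneg (by positivity), hg]
    have : Real.exp (-(z / s)) ≤ 1 := Real.exp_le_one_iff.2 (by
      have : 0 < z / s := by positivity
      linarith)
    calc s ^ (a - 1) * Real.exp (-s) * Real.exp (-(z / s)) ≤ s ^ (a - 1) * Real.exp (-s) * 1 := by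
          gcongr
      _ = _ := by ring
  have himg : (fun t : ℝ => √z * Real.exp t) '' Set.univ = Set.Ioi 0 := by
    rw [Set.image_univ]
    ext s
    constructor
    · rintro ⟨t, rfl⟩; exact mul_pos hsz (Real.exp_pos t)
    · intro hs
      have hs' : 0 < s := hs
      refine ⟨Real.log (s / √z), ?_⟩
      simp only
      rw [Real.exp_log (by positivity), mul_div_cancel₀ _ hsz.ne']
  have hder : ∀ t ∈ Set.univ, HasDerivWithinAt (fun t : ℝ => √z * Real.exp t) (√z * Real.exp t)
      Set.univ t := fun t _ => ((Real.hasDerivAt_exp t).const_mul _).hasDerivWithinAt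
  have hinj : Set.InjOn (fun t : ℝ => √z * Real.exp t) Set.univ := fun s _ t _ hst =>
    Real.exp_injective (mul_left_cancel₀ hsz.ne' hst)
  set w : ℝ → ℝ := fun t => Real.exp (a * t) * Real.exp (-(2 * √z) * Real.cosh t) with hw
  have hsub : ∀ t : ℝ, |√z * Real.exp t| • g (√z * Real.exp t) = z ^ (a / 2) * w t := by
    intro t
    have hpos : 0 < √z * Real.exp t := mul_pos hsz (Real.exp_pos t)
    have h1 : (√z * Real.exp t) * (√z * Real.exp t) ^ (a - 1) = z ^ (a / 2) * Real.exp (a * t) := by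
      rw [mul_comm, ← Real.rpow_add_one hpos.ne', sub_add_cancel,
        Real.mul_rpow hsz.le (Real.exp_pos t).le, ← Real.exp_mul, mul_comm t, Real.sqrt_eq_rpow,
        ← Real.rpow_mul hz.le]
      congr 2; ring
    have h2 : Real.exp (-(√z * Real.exp t)) * Real.exp (-(z / (√z * Real.exp t))) =
        Real.exp (-(2 * √z) * Real.cosh t) := by
      rw [← Real.exp_add, Real.cosh_eq, Real.exp_neg]
      congr 1
      have : z = √z * √z := (Real.mul_self_sqrt hz.le).symm
      have he := (Real.exp_pos t).ne'
      have : z / (√z * Real.exp t) = √z * (Real.exp t)⁻¹ := by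
        nth_rewrite 1 [this]; field_simp
      rw [this]; ring
    simp only [hg, hw, smul_eq_mul, abs_of_pos hpos]
    rw [← h2]
    linear_combination (Real.exp (-(√z * Real.exp t)) *
      Real.exp (-(z / (√z * Real.exp t)))) * h1
  have hwi : Integrable w := by
    have h := (integrableOn_image_iff_integrableOn_abs_deriv_smul MeasurableSet.univ hder hinj
      g).1 (by rw [himg]; exact hgi)
    simp_rw [hsub, integrableOn_univ] at h
    refine (h.const_mul (z ^ (a / 2))⁻¹).congr (ae_of_all _ fun t => ?_)
    have : z ^ (a / 2) ≠ 0 := (Real.rpow_pos_of_pos hz _).ne'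
    simp only
    field_simp
  have hint := integral_image_eq_integral_abs_deriv_smul MeasurableSet.univ hder hinj g
  simp_rw [himg, hsub, setIntegral_univ, integral_const_mul] at hint
  have hsym : ∫ t, w t = 2 * besselK a (2 * √z) := by
    have h1 : ∫ t, w (-t) = ∫ t, w t := integral_neg_eq_self w volume
    have h2 : ∫ t, (w t + w (-t)) = (∫ t, w t) + ∫ t, w (-t) := integral_add hwi hwi.comp_neg
    have h3 : ∀ t : ℝ, w t + w (-t) =
        2 * (Real.exp (-(2 * √z) * Real.cosh |t|) * Real.cosh (a * |t|)) := by
      intro t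
      have : Real.cosh (a * |t|) = Real.cosh (a * t) := by
        rw [← Real.cosh_abs (a * t), abs_mul, abs_of_pos ha]
      simp only [hw]
      rw [this, Real.cosh_neg, Real.cosh_abs, Real.cosh_eq (a * t), mul_neg]
      ring
    simp_rw [h3] at h2
    rw [integral_const_mul,
      integral_comp_abs (f := fun t => Real.exp (-(2 * √z) * Real.cosh t) * Real.cosh (a * t)),
      h1] at h2
    rw [besselK]
    linarith
  rw [integral_gammaMeasure_one ha]
  have : ∀ s ∈ Set.Ioi (0 : ℝ), (s ^ (a - 1) * Real.exp (-s) / Real.Gamma a) •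
      Real.exp (-(z / s)) = (1 / Real.Gamma a) * g s := by
    intro s _; simp only [hg, smul_eq_mul]; ring
  rw [setIntegral_congr_fun measurableSet_Ioi this, integral_const_mul, hint, hsym]
  ring

/-! ### Complex normal laws -/

instance (N : ℝ) : IsProbabilityMeasure (complexNormal N) :=
  Measure.isProbabilityMeasure_map Complex.measurableEquivRealProd.symm.measurable.aemeasurable

lemma integral_complexNormal {E : Type*} [NormedAddCommGroup E] [NormedSpace ℝ E] (N : ℝ)
    (f : ℂ → E) : ∫ z, f z ∂complexNormal N =
      ∫ q : ℝ × ℝ, f ⟨q.1, q.2⟩ ∂((gaussianReal 0 (N / 2).toNNReal).prod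
        (gaussianReal 0 (N / 2).toNNReal)) := by
  rw [complexNormal, integral_map_equiv]
  rfl

lemma charFun_complexNormal {N : ℝ} (hN : 0 ≤ N) (t : ℂ) :
    charFun (complexNormal N) t = Complex.exp (-(N * ‖t‖ ^ 2 / 4 : ℝ)) := by
  rw [charFun_apply, integral_complexNormal]
  have h : ∀ q : ℝ × ℝ, Complex.exp ((inner ℝ (⟨q.1, q.2⟩ : ℂ) t : ℝ) * Complex.I) =
      Complex.exp (t.re * q.1 * Complex.I) * Complex.exp (t.im * q.2 * Complex.I) := by
    intro q
    rw [← Complex.exp_add, Complex.inner]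
    congr 1
    simp only [Complex.mul_re, Complex.conj_re, Complex.conj_im]
    push_cast
    ring
  simp_rw [h]
  rw [integral_prod_mul (fun x : ℝ => Complex.exp (t.re * x * Complex.I))
    (fun y : ℝ => Complex.exp (t.im * y * Complex.I)), ← charFun_apply_real, ← charFun_apply_real,
    charFun_gaussianReal, charFun_gaussianReal, ← Complex.exp_add, Real.coe_toNNReal _ (by positivity),
    ← Complex.normSq_eq_norm_sq, Complex.normSq_apply]
  congr 1
  push_cast
  ring

lemma map_sum_conj_mul_complexNormal {ι : Type*} [Fintype ι] {N : ℝ} (hN : 0 ≤ N) (c : ι → ℂ) :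
    (Measure.pi fun _ : ι => complexNormal N).map (fun r => ∑ m, star (r m) * c m) =
      complexNormal (N * ∑ m, ‖c m‖ ^ 2) := by
  have hmeas : Measurable fun r : ι → ℂ => ∑ m, star (r m) * c m :=
    Continuous.measurable (by fun_prop)
  have := Measure.isProbabilityMeasure_map (μ := Measure.pi fun _ : ι => complexNormal N)
    hmeas.aemeasurable
  refine Measure.ext_of_charFun (funext fun t => ?_)
  rw [charFun_complexNormal (by positivity), charFun_apply,
    integral_map hmeas.aemeasurable (by fun_prop)]
  -- The real inner product satisfies `⟪r̄ c, t⟫ = ⟪r, t̄ c⟫`, so the conjugation moves to the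
  -- frequency, where only the modulus matters for a circular law.
  have h : ∀ r : ι → ℂ, Complex.exp ((inner ℝ (∑ m, star (r m) * c m) t : ℝ) * Complex.I) =
      ∏ m, Complex.exp ((inner ℝ (r m) (star t * c m) : ℝ) * Complex.I) := by
    intro r
    rw [← Complex.exp_sum, sum_inner, Complex.ofReal_sum, Finset.sum_mul]
    congr 1
    refine Finset.sum_congr rfl fun m _ => ?_
    congr 2
    rw [Complex.inner, Complex.inner]
    simp
    ring
  simp_rw [h]
  rw [integral_fintype_prod_eq_prod
    (fun m (z : ℂ) => Complex.exp ((inner ℝ z (star t * c m) : ℝ) * Complex.I))]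
  simp_rw [← charFun_apply, charFun_complexNormal hN]
  rw [← Complex.exp_sum]
  congr 1
  simp only [norm_mul, norm_star, mul_pow]
  push_cast
  rw [Finset.mul_sum, Finset.sum_mul, Finset.sum_div, ← Finset.sum_neg_distrib]
  exact Finset.sum_congr rfl fun m _ => by ring

/-- Real and imaginary part contribute one factor each, so only the square is needed; squaring also
disposes of the branch of the complex square root. -/
lemma integral_cexp_sq_gaussianReal {N : ℝ} (hN : 0 < N) (t : ℝ) :
    (∫ x, Complex.exp (t * (x ^ 2 / N) * Complex.I) ∂gaussianReal 0 (N / 2).toNNReal) ^ 2 =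
      1 / (1 - t * Complex.I) := by
  have hv : (N / 2).toNNReal ≠ 0 := by simpa using hN
  have hNc : (N : ℂ) ≠ 0 := by exact_mod_cast hN.ne'
  have hpi : (Real.pi : ℂ) ≠ 0 := by exact_mod_cast Real.pi_ne_zero
  rw [integral_gaussianReal_eq_integral_smul hv]
  have h : ∀ x : ℝ, gaussianPDFReal 0 (N / 2).toNNReal x •
      Complex.exp (t * (x ^ 2 / N) * Complex.I) =
      ((√(Real.pi * N))⁻¹ : ℝ) * Complex.exp (-((1 - t * Complex.I) / N) * x ^ 2) := by
    intro x
    rw [gaussianPDFReal, Real.coe_toNNReal _ (by positivity), Complex.real_smul,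
      show 2 * Real.pi * (N / 2) = Real.pi * N by ring, Complex.ofReal_mul, mul_assoc,
      Complex.ofReal_exp, ← Complex.exp_add]
    congr 2
    push_cast
    field_simp
    ring
  simp_rw [h]
  rw [integral_const_mul, integral_gaussian_complex, mul_pow,
    show (1 / 2 : ℂ) = ((2 : ℕ) : ℂ)⁻¹ by norm_num, Complex.cpow_nat_inv_pow _ two_ne_zero,
    ← Complex.ofReal_pow, inv_pow, Real.sq_sqrt (by positivity)]
  · have := one_sub_mul_I_ne_zero t
    push_cast
    field_simp
  · rw [Complex.div_ofReal_re]
    simpa using hN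

lemma map_norm_sq_div_complexNormal {N : ℝ} (hN : 0 < N) :
    (complexNormal N).map (fun z => ‖z‖ ^ 2 / N) = gammaMeasure 1 1 := by
  have hmeas : Measurable fun z : ℂ => ‖z‖ ^ 2 / N := by fun_prop
  have := Measure.isProbabilityMeasure_map (μ := complexNormal N) hmeas.aemeasurable
  have := isProbabilityMeasure_gammaMeasure one_pos one_pos
  refine Measure.ext_of_charFun (funext fun t => ?_)
  have h1 := charFun_gammaMeasure_one 0 t
  simp only [zero_add, Nat.cast_one, pow_one] at h1
  rw [h1, charFun_apply_real, integral_map hmeas.aemeasurable (by fun_prop), integral_complexNormal]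
  have h : ∀ q : ℝ × ℝ, Complex.exp (t * (‖(⟨q.1, q.2⟩ : ℂ)‖ ^ 2 / N : ℝ) * Complex.I) =
      Complex.exp (t * (q.1 ^ 2 / N) * Complex.I) *
        Complex.exp (t * (q.2 ^ 2 / N) * Complex.I) := by
    intro q
    rw [← Complex.exp_add, ← Complex.normSq_eq_norm_sq, Complex.normSq_apply]
    congr 1
    push_cast
    ring
  simp_rw [h]
  rw [integral_prod_mul (fun x : ℝ => Complex.exp (t * (x ^ 2 / N) * Complex.I))
    (fun x : ℝ => Complex.exp (t * (x ^ 2 / N) * Complex.I)), ← sq, integral_cexp_sq_gaussianReal hN]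

lemma map_sum_norm_sq_div_complexNormal {ι : Type*} [Fintype ι] {N : ℝ} (hN : 0 < N)
    {s : Finset ι} (hs : s.Nonempty) :
    (Measure.pi fun _ : ι => complexNormal N).map (fun b => (∑ m ∈ s, ‖b m‖ ^ 2) / N) =
      gammaMeasure s.card 1 := by
  classical
  have hmeas : Measurable fun b : ι → ℂ => (∑ m ∈ s, ‖b m‖ ^ 2) / N := by fun_prop
  have := Measure.isProbabilityMeasure_map (μ := Measure.pi fun _ : ι => complexNormal N)
    hmeas.aemeasurable
  have hcard : 0 < s.card := Finset.card_pos.2 hs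
  have := isProbabilityMeasure_gammaMeasure (a := (s.card : ℝ)) (by exact_mod_cast hcard) one_pos
  refine Measure.ext_of_charFun (funext fun t => ?_)
  obtain ⟨n, hn⟩ := Nat.exists_eq_add_of_le' hcard
  rw [hn, charFun_gammaMeasure_one, charFun_apply_real,
    integral_map hmeas.aemeasurable (by fun_prop)]
  have h : ∀ b : ι → ℂ, Complex.exp (t * ((∑ m ∈ s, ‖b m‖ ^ 2) / N : ℝ) * Complex.I) =
      ∏ m, (if m ∈ s then Complex.exp (t * (‖b m‖ ^ 2 / N : ℝ) * Complex.I) else 1) := by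
    intro b
    rw [Finset.prod_ite_mem, Finset.univ_inter, ← Complex.exp_sum, Finset.sum_div]
    congr 1
    push_cast
    rw [Finset.mul_sum, Finset.sum_mul]
  simp_rw [h]
  rw [integral_fintype_prod_eq_prod
    (fun m (z : ℂ) => if m ∈ s then Complex.exp (t * (‖z‖ ^ 2 / N : ℝ) * Complex.I) else 1)]
  have h1 : ∀ m, (∫ z : ℂ, (if m ∈ s then Complex.exp (t * (‖z‖ ^ 2 / N : ℝ) * Complex.I) else 1)
      ∂complexNormal N) = if m ∈ s then 1 / (1 - t * Complex.I) else 1 := by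
    intro m
    split_ifs
    · have h2 := charFun_gammaMeasure_one 0 t
      simp only [zero_add, Nat.cast_one, pow_one] at h2
      rw [← h2, ← map_norm_sq_div_complexNormal hN, charFun_apply_real,
        integral_map (by fun_prop) (by fun_prop)]
    · simp
  simp_rw [h1]
  rw [Finset.prod_ite_mem, Finset.univ_inter, Finset.prod_const, hn, div_pow, one_pow]

lemma complexNormal_norm_sq_lt {N x : ℝ} (hN : 0 < N) (hx : 0 ≤ x) :
    (complexNormal N).real {z | ‖z‖ ^ 2 < x} = 1 - Real.exp (-(x / N)) := by
  rw [← gammaMeasure_one_Iio (by positivity), ← map_norm_sq_div_complexNormal hN,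
    map_measureReal_apply (by fun_prop) measurableSet_Iio]
  congr 1
  ext z
  simp [div_lt_div_iff_of_pos_right hN]

lemma integral_norm_sq_complexNormal {N : ℝ} (hN : 0 < N) :
    Integrable (fun z => ‖z‖ ^ 2) (complexNormal N) ∧ ∫ z, ‖z‖ ^ 2 ∂complexNormal N = N := by
  obtain ⟨h1, h2⟩ := integral_id_gammaMeasure_one one_pos
  rw [← map_norm_sq_div_complexNormal hN] at h1 h2
  rw [integrable_map_measure (by fun_prop) (by fun_prop)] at h1
  rw [integral_map (by fun_prop) (by fun_prop), integral_div, div_eq_one_iff_eq hN.ne'] at h2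
  refine ⟨(h1.mul_const N).congr (ae_of_all _ fun z => ?_), h2⟩
  simp only [Function.comp]
  field_simp

section

/-! ### The law of the cascaded channel gain -/

lemma cascade_eq_sum {P Q : ℕ} (p : Fin P) (r b : Fin P × Fin Q → ℂ) :
    cascade p r b = ∑ m, star (r m) * if m.1 = p then b m else 0 := by
  simp only [cascade, dotProduct, Matrix.mulVec_diagonal, onOffColumn, Matrix.kroneckerMap_apply,
    Matrix.one_apply, Pi.star_apply, Matrix.of_apply]
  refine Finset.sum_congr rfl fun m _ => ?_
  split_ifs <;> simp

/-- The indices of the elements that `v_p` switches on. -/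
def onElements {P : ℕ} (Q : ℕ) (p : Fin P) : Finset (Fin P × Fin Q) :=
  Finset.univ.filter fun m => m.1 = p

lemma card_onElements {P : ℕ} (Q : ℕ) (p : Fin P) : (onElements Q p).card = Q := by
  have : onElements Q p = {p} ×ˢ (Finset.univ : Finset (Fin Q)) := by
    ext m; simp only [onElements, Finset.mem_filter, Finset.mem_univ, true_and, Finset.mem_product,
      Finset.mem_singleton, and_true]
  rw [this]; simp

lemma sum_norm_sq_onElements {P Q : ℕ} (p : Fin P) (b : Fin P × Fin Q → ℂ) :
    ∑ m, ‖if m.1 = p then b m else 0‖ ^ 2 = ∑ m ∈ onElements Q p, ‖b m‖ ^ 2 := by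
  rw [onElements, Finset.sum_filter]
  refine Finset.sum_congr rfl fun m _ => ?_
  split_ifs <;> simp

/-- This is the conditional law given the BS-RIS coefficients; it depends on them only through their
total power over the active elements. -/
lemma map_cascade {P Q : ℕ} (p : Fin P) {N : ℝ} (hN : 0 ≤ N) (b : Fin P × Fin Q → ℂ) :
    (Measure.pi fun _ : Fin P × Fin Q => complexNormal N).map (fun r => cascade p r b) =
      complexNormal (N * ∑ m ∈ onElements Q p, ‖b m‖ ^ 2) := by
  simp_rw [cascade_eq_sum]
  rw [map_sum_conj_mul_complexNormal hN, sum_norm_sq_onElements]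

@[fun_prop]
lemma continuous_cascade {P Q : ℕ} (p : Fin P) :
    Continuous fun q : (Fin P × Fin Q → ℂ) × (Fin P × Fin Q → ℂ) => cascade p q.2 q.1 := by
  simp_rw [cascade_eq_sum]
  refine continuous_finsetSum _ fun m _ => ?_
  split_ifs <;> fun_prop

variable {Ω : Type*} [MeasurableSpace Ω] {μ : Measure Ω} {θ : Params}
  {h : Coeff θ.K θ.P θ.Q → Ω → ℂ}

/-- The joint law of the coefficients between BS and RIS and those between RIS and user `j`. -/
lemma IsFading.hasLaw_br_ru [IsProbabilityMeasure μ] (hh : IsFading μ θ h) (j : User θ.K) :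
    HasLaw (fun ω => (fun m => h (.br m) ω, fun m => h (.ru j m) ω))
      ((Measure.pi fun _ : Fin θ.P × Fin θ.Q => complexNormal θ.Nbr).prod
        (Measure.pi fun _ : Fin θ.P × Fin θ.Q => complexNormal (θ.Nr j))) μ := by
  classical
  have hbr : HasLaw (fun ω m => h (.br m) ω)
      (Measure.pi fun _ : Fin θ.P × Fin θ.Q => complexNormal θ.Nbr) μ :=
    iIndepFun.hasLaw_pi (fun m => hh.hasLaw (.br m))
      (hh.indep.precomp fun m m' e => by simpa using e)
  have hru : HasLaw (fun ω m => h (.ru j m) ω)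
      (Measure.pi fun _ : Fin θ.P × Fin θ.Q => complexNormal (θ.Nr j)) μ :=
    iIndepFun.hasLaw_pi (fun m => hh.hasLaw (.ru j m))
      (hh.indep.precomp fun m m' e => by simpa using e)
  refine (indepFun_iff_hasLaw_prodMk_prod hbr hru).1 ?_
  have := hh.indep.indepFun_finset₀ (Finset.univ.image Coeff.br) (Finset.univ.image (Coeff.ru j))
    (Finset.disjoint_left.2 fun c hc hc' => by
      obtain ⟨m, -, rfl⟩ := Finset.mem_image.1 hc
      obtain ⟨m', -, e⟩ := Finset.mem_image.1 hc'
      simp at e) fun c => (hh.hasLaw c).aemeasurable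
  have hbr_meas : Measurable fun (f : (Finset.univ.image (Coeff.br (K := θ.K) (P := θ.P)
      (Q := θ.Q)) : Finset (Coeff θ.K θ.P θ.Q)) → ℂ) (m : Fin θ.P × Fin θ.Q) =>
      f ⟨.br m, Finset.mem_image_of_mem _ (Finset.mem_univ m)⟩ := by fun_prop
  have hru_meas : Measurable fun (f : (Finset.univ.image (Coeff.ru (P := θ.P) (Q := θ.Q) j) :
      Finset (Coeff θ.K θ.P θ.Q)) → ℂ) (m : Fin θ.P × Fin θ.Q) =>
      f ⟨.ru j m, Finset.mem_image_of_mem _ (Finset.mem_univ m)⟩ := by fun_prop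
  exact this.comp hbr_meas hru_meas

lemma measurable_sum_norm_sq_div {ι : Type*} (s : Finset ι) (N : ℝ) :
    Measurable fun b : ι → ℂ => (∑ m ∈ s, ‖b m‖ ^ 2) / N := by
  fun_prop

lemma aemeasurable_gain [IsProbabilityMeasure μ] (hh : IsFading μ θ h) (p : Fin θ.P)
    (j : User θ.K) : AEMeasurable (gain θ p h j) μ := by
  have : Measurable fun q : (Fin θ.P × Fin θ.Q → ℂ) × (Fin θ.P × Fin θ.Q → ℂ) =>
      ‖cascade p q.2 q.1‖ ^ 2 := ((continuous_cascade p).norm.pow 2).measurable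
  exact (this.comp_aemeasurable (hh.hasLaw_br_ru j).aemeasurable).congr
    (ae_of_all _ fun ω => by simp only [Function.comp, gain])

/-- The mean of `exp (-1 / (s u))` for `s` with the gamma law of shape `Q` and unit rate. -/
def gammaTail (Q : ℕ) (u : ℝ) : ℝ := ∫ s, expNegInvGlue (s * u) ∂gammaMeasure Q 1

lemma expNegInvGlue_le_one (u : ℝ) : expNegInvGlue u ≤ 1 := by
  rw [expNegInvGlue]
  split_ifs with hu
  · exact zero_le_one
  · exact Real.exp_le_one_iff.2 (by simpa using (not_le.1 hu).le)

lemma gammaTail_of_nonpos (Q : ℕ) {u : ℝ} (hu : u ≤ 0) : gammaTail Q u = 0 := by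
  refine integral_eq_zero_of_ae ?_
  filter_upwards [ae_pos_gammaMeasure_one Q] with s hs
  exact expNegInvGlue.zero_of_nonpos (mul_nonpos_of_nonneg_of_nonpos hs.le hu)

lemma gammaTail_eq_integral_exp (Q : ℕ) {z : ℝ} (hz : 0 < z) :
    gammaTail Q z⁻¹ = ∫ s, Real.exp (-(z / s)) ∂gammaMeasure Q 1 := by
  refine integral_congr_ae ?_
  filter_upwards [ae_pos_gammaMeasure_one Q] with s hs
  have : 0 < s * z⁻¹ := by positivity
  rw [expNegInvGlue, if_neg (not_le.2 this)]
  congr 2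
  field_simp

lemma gammaTail_inv {Q : ℕ} (hQ : 0 < Q) {z : ℝ} (hz : 0 < z) :
    gammaTail Q z⁻¹ = 2 / Real.Gamma Q * z ^ ((Q : ℝ) / 2) * besselK Q (2 * √z) := by
  rw [gammaTail_eq_integral_exp Q hz,
    integral_exp_neg_div_gammaMeasure_one (by exact_mod_cast hQ) hz]

/-- The variable is the reciprocal of the Bessel argument `z`, so that `u = 0` stands for `z = ∞`.
There `expNegInvGlue` continues `exp (-1/·)` by `0`, and dominated convergence with bound `1`
applies. -/
lemma continuous_gammaTail {Q : ℕ} (hQ : 0 < Q) : Continuous (gammaTail Q) := by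
  have := isProbabilityMeasure_gammaMeasure (a := (Q : ℝ)) (by exact_mod_cast hQ) one_pos
  have hc : Continuous expNegInvGlue := expNegInvGlue.contDiff.continuous (n := 0)
  refine continuous_of_dominated (bound := fun _ => 1) (fun u => ?_) (fun u => ?_)
    (integrable_const 1) (ae_of_all _ fun s => by fun_prop)
  · exact (by fun_prop : Continuous fun s => expNegInvGlue (s * u)).aestronglyMeasurable
  · refine ae_of_all _ fun s => ?_
    rw [Real.norm_of_nonneg (expNegInvGlue.nonneg _)]
    exact expNegInvGlue_le_one _

lemma gammaTail_mem_Icc {Q : ℕ} (hQ : 0 < Q) (u : ℝ) : gammaTail Q u ∈ Set.Icc (0 : ℝ) 1 := by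
  have := isProbabilityMeasure_gammaMeasure (a := (Q : ℝ)) (by exact_mod_cast hQ) one_pos
  refine ⟨integral_nonneg fun s => expNegInvGlue.nonneg _, ?_⟩
  have := integral_mono_of_nonneg (μ := gammaMeasure Q 1)
    (ae_of_all _ fun s => expNegInvGlue.nonneg (s * u)) (integrable_const (1 : ℝ))
    (ae_of_all _ fun s => expNegInvGlue_le_one (s * u))
  simpa [gammaTail] using this

lemma ae_sum_norm_sq_pos {P Q : ℕ} (hQ : 0 < Q) (p : Fin P) {N : ℝ} (hN : 0 < N) :
    ∀ᵐ b ∂(Measure.pi fun _ : Fin P × Fin Q => complexNormal N),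
      0 < (∑ m ∈ onElements Q p, ‖b m‖ ^ 2) / N := by
  have h1 := ae_pos_gammaMeasure_one Q
  have hs : (onElements Q p).Nonempty := Finset.card_pos.1 (by rwa [card_onElements])
  have h2 := map_sum_norm_sq_div_complexNormal hN hs
  rw [card_onElements] at h2
  rw [← h2] at h1
  exact ae_of_ae_map (measurable_sum_norm_sq_div _ _).aemeasurable h1

/-- The distribution function of the gain `|H_j|²`. -/
lemma map_gain_Iio [IsProbabilityMeasure μ] (hθ : θ.Valid) (hh : IsFading μ θ h) (p : Fin θ.P)
    (j : User θ.K) {x : ℝ} (hx : 0 < x) :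
    (μ.map (gain θ p h j)).real (Set.Iio x) =
      1 - gammaTail θ.Q (x / (θ.Nbr * θ.Nr j))⁻¹ := by
  have hNr : 0 < θ.Nr j := hθ.Nr_pos j (Finset.mem_Icc.2 j.2)
  have hNbr := hθ.Nbr_pos
  have hQ := hθ.Q_pos
  have := isProbabilityMeasure_gammaMeasure (a := (θ.Q : ℝ)) (by exact_mod_cast hQ) one_pos
  have hcont : Continuous fun q : (Fin θ.P × Fin θ.Q → ℂ) × (Fin θ.P × Fin θ.Q → ℂ) =>
      ‖cascade p q.2 q.1‖ ^ 2 := (continuous_cascade p).norm.pow 2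
  have hmeas : MeasurableSet {q : (Fin θ.P × Fin θ.Q → ℂ) × (Fin θ.P × Fin θ.Q → ℂ) |
      ‖cascade p q.2 q.1‖ ^ 2 < x} := measurableSet_lt hcont.measurable measurable_const
  rw [map_measureReal_apply_of_aemeasurable (aemeasurable_gain hh p j) measurableSet_Iio]
  have h1 := (hh.hasLaw_br_ru j).measureReal_eq hmeas
  have h2 : gain θ p h j ⁻¹' Set.Iio x = {ω | ‖cascade p (fun m => h (.ru j m) ω)
      (fun m => h (.br m) ω)‖ ^ 2 < x} := rfl
  rw [h2, h1, measureReal_def, Measure.prod_apply hmeas,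
    ← integral_toReal (measurable_measure_prodMk_left hmeas).aemeasurable
      (ae_of_all _ fun b => measure_lt_top _ _)]
  have hs : (onElements θ.Q p).Nonempty := Finset.card_pos.1 (by rwa [card_onElements])
  have hlaw := map_sum_norm_sq_div_complexNormal hNbr hs
  rw [card_onElements] at hlaw
  have hz : 0 < x / (θ.Nbr * θ.Nr j) := by positivity
  -- Given `b`, the gain is exponential with mean `N_rj ∑ ‖b m‖²`. The tail is expressed through the
  -- normalised sum, whose law is gamma of shape `Q`.
  have h3 : ∀ᵐ b ∂(Measure.pi fun _ : Fin θ.P × Fin θ.Q => complexNormal θ.Nbr),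
      ((Measure.pi fun _ : Fin θ.P × Fin θ.Q => complexNormal (θ.Nr j))
        (Prod.mk b ⁻¹' {q | ‖cascade p q.2 q.1‖ ^ 2 < x})).toReal =
      1 - Real.exp (-(x / (θ.Nbr * θ.Nr j) /
        ((∑ m ∈ onElements θ.Q p, ‖b m‖ ^ 2) / θ.Nbr))) := by
    filter_upwards [ae_sum_norm_sq_pos hQ p hNbr] with b hb
    have hb' : 0 < ∑ m ∈ onElements θ.Q p, ‖b m‖ ^ 2 := by
      have := mul_pos hb hNbr
      rwa [div_mul_cancel₀ _ hNbr.ne'] at this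
    have h4 := complexNormal_norm_sq_lt (mul_pos hNr hb') hx.le
    have hm : Measurable fun r => cascade p r b :=
      ((continuous_cascade p).comp (Continuous.prodMk_right b)).measurable
    have hset : MeasurableSet {z : ℂ | ‖z‖ ^ 2 < x} :=
      measurableSet_lt (by fun_prop) measurable_const
    rw [← map_cascade p hNr.le b, map_measureReal_apply hm hset] at h4
    refine h4.trans ?_
    congr 3
    field_simp
  rw [integral_congr_ae h3, gammaTail_eq_integral_exp _ hz, ← hlaw,
    integral_map (measurable_sum_norm_sq_div _ _).aemeasurable
      (Measurable.aestronglyMeasurable (by fun_prop)), integral_sub (integrable_const _)]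
  · simp
  · refine Integrable.of_bound (C := 1) (Measurable.aestronglyMeasurable (by fun_prop)) (ae_of_all _ fun b => ?_)
    rw [Real.norm_of_nonneg (Real.exp_pos _).le, Real.exp_le_one_iff, neg_nonpos]
    positivity

/-- The mean of the gain `|H_j|²`. -/
lemma integral_gain [IsProbabilityMeasure μ] (hθ : θ.Valid) (hh : IsFading μ θ h) (p : Fin θ.P)
    (j : User θ.K) : Integrable (gain θ p h j) μ ∧
      ∫ ω, gain θ p h j ω ∂μ = θ.Q * θ.Nbr * θ.Nr j := by
  have hNr : 0 < θ.Nr j := hθ.Nr_pos j (Finset.mem_Icc.2 j.2)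
  have hNbr := hθ.Nbr_pos
  have hQ := hθ.Q_pos
  have hcont : Continuous fun q : (Fin θ.P × Fin θ.Q → ℂ) × (Fin θ.P × Fin θ.Q → ℂ) =>
      ‖cascade p q.2 q.1‖ ^ 2 := (continuous_cascade p).norm.pow 2
  have hlaw := hh.hasLaw_br_ru j
  have hs : (onElements θ.Q p).Nonempty := Finset.card_pos.1 (by rwa [card_onElements])
  have hsum := map_sum_norm_sq_div_complexNormal hNbr hs
  rw [card_onElements] at hsum
  obtain ⟨hi, he⟩ := integral_id_gammaMeasure_one (a := (θ.Q : ℝ)) (by exact_mod_cast hQ)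
  rw [← hsum, integrable_map_measure (by fun_prop)
    (measurable_sum_norm_sq_div _ _).aemeasurable] at hi
  rw [← hsum, integral_map (measurable_sum_norm_sq_div _ _).aemeasurable (by fun_prop)] at he
  have hcond : ∀ᵐ b ∂(Measure.pi fun _ : Fin θ.P × Fin θ.Q => complexNormal θ.Nbr),
      Integrable (fun r => ‖cascade p r b‖ ^ 2)
        (Measure.pi fun _ : Fin θ.P × Fin θ.Q => complexNormal (θ.Nr j)) ∧
      ∫ r, ‖cascade p r b‖ ^ 2 ∂(Measure.pi fun _ : Fin θ.P × Fin θ.Q => complexNormal (θ.Nr j)) =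
        (θ.Nbr * θ.Nr j) * ((∑ m ∈ onElements θ.Q p, ‖b m‖ ^ 2) / θ.Nbr) := by
    filter_upwards [ae_sum_norm_sq_pos hQ p hNbr] with b hb
    have hb' : 0 < ∑ m ∈ onElements θ.Q p, ‖b m‖ ^ 2 := by
      have := mul_pos hb hNbr
      rwa [div_mul_cancel₀ _ hNbr.ne'] at this
    have hm : Measurable fun r => cascade p r b :=
      ((continuous_cascade p).comp (Continuous.prodMk_right b)).measurable
    obtain ⟨h1, h2⟩ := integral_norm_sq_complexNormal (mul_pos hNr hb')
    rw [← map_cascade p hNr.le b] at h1 h2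
    rw [integrable_map_measure (by fun_prop) hm.aemeasurable] at h1
    rw [integral_map hm.aemeasurable (by fun_prop)] at h2
    refine ⟨h1, h2.trans ?_⟩
    field_simp
  -- The integrand is nonnegative, so joint integrability reduces to integrability of the
  -- conditional mean, a multiple of a gamma variable.
  have hI : Integrable (fun q : (Fin θ.P × Fin θ.Q → ℂ) × (Fin θ.P × Fin θ.Q → ℂ) =>
      ‖cascade p q.2 q.1‖ ^ 2) ((Measure.pi fun _ : Fin θ.P × Fin θ.Q => complexNormal θ.Nbr).prod
        (Measure.pi fun _ : Fin θ.P × Fin θ.Q => complexNormal (θ.Nr j))) := by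
    rw [integrable_prod_iff hcont.aestronglyMeasurable]
    refine ⟨hcond.mono fun b hb => hb.1, (hi.const_mul (θ.Nbr * θ.Nr j)).congr ?_⟩
    filter_upwards [hcond] with b hb
    simp only [norm_pow, norm_norm]
    exact hb.2.symm
  refine ⟨?_, ?_⟩
  · rw [← hlaw.map_eq] at hI
    exact hI.comp_aemeasurable hlaw.aemeasurable
  · have h1 := hlaw.integral_comp (f := fun q => ‖cascade p q.2 q.1‖ ^ 2) hcont.aestronglyMeasurable
    have h2 : ∫ ω, gain θ p h j ω ∂μ = ∫ q : (Fin θ.P × Fin θ.Q → ℂ) × (Fin θ.P × Fin θ.Q → ℂ),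
        ‖cascade p q.2 q.1‖ ^ 2 ∂((Measure.pi fun _ : Fin θ.P × Fin θ.Q => complexNormal θ.Nbr).prod
          (Measure.pi fun _ : Fin θ.P × Fin θ.Q => complexNormal (θ.Nr j))) := h1
    rw [h2, integral_prod _ hI, integral_congr_ae (hcond.mono fun b hb => hb.2), integral_const_mul,
      he]
    ring

end

/-! ### Secrecy outage -/

lemma secrecyRate_lt_iff {γ γE R : ℝ} (hγ : 0 ≤ γ) (hγE : 0 ≤ γE) (hR : 0 < R) :
    secrecyRate γ γE < R ↔ γ < (2 : ℝ) ^ R * (1 + γE) - 1 := by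
  have h1 : 0 < 1 + γ := by linarith
  have h2 : 0 < 1 + γE := by linarith
  have h3 : Real.logb 2 ((2 : ℝ) ^ R * (1 + γE)) = R + Real.logb 2 (1 + γE) := by
    rw [Real.logb_mul (by positivity) h2.ne', Real.logb_rpow two_pos (by norm_num)]
  -- As `0 < R`, the truncation at `0` does not affect the event.
  rw [secrecyRate, max_lt_iff, and_iff_left hR, sub_lt_iff_lt_add, ← h3,
    Real.logb_lt_logb_iff one_lt_two h1 (by positivity), lt_sub_iff_add_lt']

lemma Params.Valid.ν_nonneg {θ : Params} (hθ : θ.Valid) (k : ℕ) : 0 ≤ θ.ν k :=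
  Finset.sum_nonneg fun i hi => (hθ.a_pos i (Finset.mem_Icc.2
    ⟨by have := (Finset.mem_Icc.1 hi).1; omega, (Finset.mem_Icc.1 hi).2⟩)).le

lemma Params.Valid.a_pos' {θ : Params} (hθ : θ.Valid) (k : User θ.K) : 0 < θ.a k :=
  hθ.a_pos k (Finset.mem_Icc.2 k.2)

lemma Params.Valid.Nr_pos' {θ : Params} (hθ : θ.Valid) (k : User θ.K) : 0 < θ.Nr k :=
  hθ.Nr_pos k (Finset.mem_Icc.2 k.2)

lemma sinr_nonneg {θ : Params} (hθ : θ.Valid) (k : User θ.K) {r x y : ℝ} (hr : 0 < r)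
    (hx : 0 ≤ x) (hy : 0 ≤ y) : 0 ≤ sinr θ k r x y := by
  have h1 := hθ.ν_nonneg k
  have h2 := hθ.a_pos' k
  have h3 := hθ.ϖ_mem.1
  rw [sinr]; positivity

lemma sinr_lt_iff {θ : Params} (hθ : θ.Valid) (k : User θ.K) {r x y t : ℝ} (hr : 0 < r)
    (hx : 0 ≤ x) (hy : 0 ≤ y) (ht : t * θ.ν k < θ.a k) :
    sinr θ k r x y < t ↔ x < t * (θ.ϖ * r * y + 1) / (r * (θ.a k - t * θ.ν k)) := by
  have h1 := hθ.ν_nonneg k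
  have h3 := hθ.ϖ_mem.1
  have h4 : 0 < θ.a k - t * θ.ν k := by linarith
  rw [sinr, div_lt_iff₀ (by positivity), lt_div_iff₀ (by positivity)]
  constructor <;> intro h <;> nlinarith

/-- However large the gain, interference from the other users caps the ratio at `a_k / ν_k`, and the
noise term `1` keeps the inequality strict. -/
lemma sinr_lt_of_le {θ : Params} (hθ : θ.Valid) (k : User θ.K) {r x y t : ℝ} (hr : 0 < r)
    (hx : 0 ≤ x) (hy : 0 ≤ y) (ht0 : 0 < t) (ht : θ.a k ≤ t * θ.ν k) : sinr θ k r x y < t := by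
  have h1 := hθ.ν_nonneg k
  have h3 := hθ.ϖ_mem.1
  rw [sinr, div_lt_iff₀ (by positivity)]
  have h5 : r * x * θ.a k ≤ r * x * (t * θ.ν k) := by gcongr
  have h6 : 0 < t * (θ.ϖ * r * y + 1) := by positivity
  nlinarith

/-- The threshold as a function of the normalised interference at the eavesdropper. -/
lemma ϑ_eq_sinr (θ : Params) (k : ℕ) (R s : ℝ) : θ.ϑ k R s =
    (2 : ℝ) ^ R * (1 + sinr θ k θ.ρe (θ.Q * θ.Nbr * θ.Nr 1) (θ.Nipe * s)) - 1 := by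
  rw [Params.ϑ, sinr,
    show θ.ρe * (θ.Q * θ.Nbr * θ.Nr 1) * θ.a k = θ.Q * θ.Nbr * θ.Nr 1 * θ.a k * θ.ρe by ring,
    show θ.ρe * (θ.Q * θ.Nbr * θ.Nr 1) * θ.ν k + θ.ϖ * θ.ρe * (θ.Nipe * s) + 1 =
      θ.ρe * θ.Q * θ.Nbr * θ.Nr 1 * θ.ν k + θ.ϖ * θ.ρe * θ.Nipe * s + 1 by ring]

lemma Params.Valid.Nr_one_pos {θ : Params} (hθ : θ.Valid) (k : User θ.K) : 0 < θ.Nr 1 :=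
  hθ.Nr_pos' k.first

lemma ϑ_pos {θ : Params} (hθ : θ.Valid) (k : User θ.K) {R s : ℝ} (hR : 0 < R) (hs : 0 ≤ s) :
    0 < θ.ϑ k R s := by
  have h1 := hθ.Nr_one_pos k
  have h2 := hθ.Nbr_pos
  have h3 := hθ.Nipe_pos
  have h4 := sinr_nonneg hθ k hθ.ρe_pos (x := θ.Q * θ.Nbr * θ.Nr 1) (y := θ.Nipe * s)
    (by positivity) (by positivity)
  have h5 : 1 < (2 : ℝ) ^ R := Real.one_lt_rpow one_lt_two hR
  rw [ϑ_eq_sinr]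
  nlinarith

lemma ζ₁_pos {θ : Params} (hθ : θ.Valid) (k : User θ.K) {d : ℝ} (hd : 0 ≤ d) :
    0 < θ.ζ₁ k d := by
  have h1 := hθ.Nr_pos' k
  have h2 := hθ.Nbr_pos
  have h3 := hθ.Nipu_pos
  have h4 := hθ.ρ_pos
  have h5 := hθ.ϖ_mem.1
  rw [Params.ζ₁]
  positivity

/-- `base` in terms of a function that is continuous across `a_k = x ν_k`. -/
lemma base_eq_gammaTail {θ : Params} (hθ : θ.Valid) (k : ℕ) {ζ x : ℝ} (hζ : 0 < ζ) (hx : 0 < x) :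
    θ.base k ζ x = 1 - gammaTail θ.Q ((θ.a k - x * θ.ν k) / (ζ * x)) := by
  rw [Params.base]
  split_ifs with h
  · have h1 : 0 < θ.a k - x * θ.ν k := by linarith
    rw [← inv_div (ζ * x), gammaTail_inv hθ.Q_pos (by positivity)]
  · rw [gammaTail_of_nonpos, sub_zero]
    exact div_nonpos_of_nonpos_of_nonneg (by linarith) (by positivity)

/-- The outage probability of the `k`-th order statistic as a function of the value of the
distribution function. -/
def orderStatPoly (θ : Params) (k : ℕ) (F : ℝ) : ℝ :=
  θ.κ k * ∑ l ∈ Finset.range (θ.K - k + 1),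
    ((θ.K - k).choose l : ℝ) * ((-1) ^ l / ((k : ℝ) + l)) * F ^ (k + l)

/-- At success probability `1` only the top term of the binomial tail remains. This covers
thresholds that the SINR cannot exceed. -/
lemma orderStatPoly_one (θ : Params) (k : User θ.K) : orderStatPoly θ k 1 = 1 := by
  rw [orderStatPoly, Params.κ, ← sum_Icc_bernstein k.2.1 k.2.2, Finset.sum_eq_single_of_mem θ.K]
  · simp
  · exact Finset.mem_Icc.2 ⟨k.2.2, le_rfl⟩
  · intro i hi hne
    have := (Finset.mem_Icc.1 hi).2
    rw [sub_self, zero_pow (by omega)]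
    simp

lemma orderStatPoly_zero (θ : Params) (k : User θ.K) : orderStatPoly θ k 0 = 0 := by
  rw [orderStatPoly, Finset.sum_eq_zero, mul_zero]
  intro l _
  have := k.2.1
  rw [zero_pow (by omega), mul_zero]

section
variable {Ω : Type*} [MeasurableSpace Ω] {μ : Measure Ω} [IsProbabilityMeasure μ] {θ : Params}
  {h : Coeff θ.K θ.P θ.Q → Ω → ℂ}

lemma isProbabilityMeasure_orderStatLaw {K k : ℕ} (hk : 1 ≤ k) (hkK : k ≤ K) (L : Measure ℝ)
    [IsProbabilityMeasure L] : IsProbabilityMeasure (orderStatLaw K k L) :=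
  Measure.isProbabilityMeasure_map (measurable_kthSmallest hk hkK).aemeasurable

lemma ae_nonneg_orderStatLaw (hh : IsFading μ θ h) (p : Fin θ.P) (k : User θ.K) :
    ∀ᵐ x ∂orderStatLaw θ.K k (μ.map (gain θ p h k)), 0 ≤ x := by
  have := Measure.isProbabilityMeasure_map (aemeasurable_gain hh p k)
  have := isProbabilityMeasure_orderStatLaw k.2.1 k.2.2 (μ.map (gain θ p h k))
  have h0 : (μ.map (gain θ p h k)).real (Set.Iio 0) = 0 := by
    rw [map_measureReal_apply_of_aemeasurable (aemeasurable_gain hh p k) measurableSet_Iio]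
    have : gain θ p h k ⁻¹' Set.Iio 0 = ∅ := by
      ext ω
      simp only [Set.mem_preimage, Set.mem_Iio, Set.mem_empty_iff_false, iff_false, not_lt]
      exact sq_nonneg _
    rw [this, measureReal_empty]
  have h1 := orderStatLaw_Iio k.2.1 k.2.2 (μ.map (gain θ p h k)) 0
  rw [h0] at h1
  have h2 : (orderStatLaw θ.K k (μ.map (gain θ p h k))).real (Set.Iio 0) = 0 :=
    h1.trans (orderStatPoly_zero θ k)
  rw [measureReal_eq_zero_iff] at h2
  rw [ae_iff]
  simpa [Set.Iio] using h2

/-- The outage probability, given the residual interferences. -/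
lemma orderStatLaw_secrecyRate_lt (hθ : θ.Valid) (hh : IsFading μ θ h) (p : Fin θ.P)
    (k : User θ.K) {R s d : ℝ} (hR : 0 < R) (hs : 0 ≤ s) (hd : 0 ≤ d) :
    (orderStatLaw θ.K k (μ.map (gain θ p h k))).real
      {x | secrecyRate (sinr θ k θ.ρ x (θ.Nipu * d))
        (sinr θ k θ.ρe (θ.Q * θ.Nbr * θ.Nr 1) (θ.Nipe * s)) < R} =
      orderStatPoly θ k (θ.base k (θ.ζ₁ k d) (θ.ϑ k R s)) := by
  have := Measure.isProbabilityMeasure_map (aemeasurable_gain hh p k)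
  have := isProbabilityMeasure_orderStatLaw k.2.1 k.2.2 (μ.map (gain θ p h k))
  have hNr := hθ.Nr_pos' k
  have hNr1 := hθ.Nr_one_pos k
  have hNbr := hθ.Nbr_pos
  have hNipu := hθ.Nipu_pos
  have hNipe := hθ.Nipe_pos
  have hρ := hθ.ρ_pos
  have hϖ := hθ.ϖ_mem.1
  have ht := ϑ_pos hθ k hR hs
  have hy : 0 ≤ θ.Nipu * d := by positivity
  have hE : 0 ≤ sinr θ k θ.ρe (θ.Q * θ.Nbr * θ.Nr 1) (θ.Nipe * s) :=
    sinr_nonneg hθ k hθ.ρe_pos (by positivity) (by positivity)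
  have hiff : ∀ x, 0 ≤ x → (secrecyRate (sinr θ k θ.ρ x (θ.Nipu * d))
      (sinr θ k θ.ρe (θ.Q * θ.Nbr * θ.Nr 1) (θ.Nipe * s)) < R ↔
      sinr θ k θ.ρ x (θ.Nipu * d) < θ.ϑ k R s) := by
    intro x hx
    rw [secrecyRate_lt_iff (sinr_nonneg hθ k hρ hx hy) hE hR, ϑ_eq_sinr]
  by_cases hcase : θ.ϑ k R s * θ.ν k < θ.a k
  · have h4 : 0 < θ.a k - θ.ϑ k R s * θ.ν k := by linarith
    have hthr : 0 < θ.ϑ k R s * (θ.ϖ * θ.ρ * (θ.Nipu * d) + 1) /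
        (θ.ρ * (θ.a k - θ.ϑ k R s * θ.ν k)) := by positivity
    have hset : {x | secrecyRate (sinr θ k θ.ρ x (θ.Nipu * d))
        (sinr θ k θ.ρe (θ.Q * θ.Nbr * θ.Nr 1) (θ.Nipe * s)) < R} =ᵐ[orderStatLaw θ.K k
          (μ.map (gain θ p h k))] Set.Iio (θ.ϑ k R s * (θ.ϖ * θ.ρ * (θ.Nipu * d) + 1) /
        (θ.ρ * (θ.a k - θ.ϑ k R s * θ.ν k))) := by
      rw [eventuallyEq_set]
      filter_upwards [ae_nonneg_orderStatLaw hh p k] with x hx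
      exact (hiff x hx).trans (sinr_lt_iff hθ k hρ hx hy hcase)
    rw [measureReal_congr hset, orderStatLaw_Iio k.2.1 k.2.2, map_gain_Iio hθ hh p k hthr,
      base_eq_gammaTail hθ k (ζ₁_pos hθ k hd) ht, orderStatPoly, Params.κ]
    have : (θ.ϑ k R s * (θ.ϖ * θ.ρ * (θ.Nipu * d) + 1) /
        (θ.ρ * (θ.a k - θ.ϑ k R s * θ.ν k)) / (θ.Nbr * θ.Nr k))⁻¹ =
        (θ.a k - θ.ϑ k R s * θ.ν k) / (θ.ζ₁ k d * θ.ϑ k R s) := by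
      rw [Params.ζ₁]
      have : θ.ϖ * θ.ρ * θ.Nipu * d + 1 ≠ 0 := by positivity
      have : θ.ϖ * θ.ρ * (θ.Nipu * d) + 1 ≠ 0 := by positivity
      field_simp
    rw [this]
  · have hset : {x | secrecyRate (sinr θ k θ.ρ x (θ.Nipu * d))
        (sinr θ k θ.ρe (θ.Q * θ.Nbr * θ.Nr 1) (θ.Nipe * s)) < R} =ᵐ[orderStatLaw θ.K k
          (μ.map (gain θ p h k))] Set.univ := by
      rw [eventuallyEq_set]
      filter_upwards [ae_nonneg_orderStatLaw hh p k] with x hx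
      simp only [Set.mem_univ, iff_true]
      exact (hiff x hx).2 (sinr_lt_of_le hθ k hρ hx hy ht (not_lt.1 hcase))
    rw [measureReal_congr hset, probReal_univ, Params.base, if_neg hcase, orderStatPoly_one]

end

/-! ### The approximate SOP as a mean over two unit exponential variables -/

/-- The outage probability given the normalised residual interferences, extended continuously to
negative arguments. -/
def condOutage (θ : Params) (k : ℕ) (R : ℝ) (q : ℝ × ℝ) : ℝ :=
  orderStatPoly θ k (1 - gammaTail θ.Q ((θ.a k - θ.ϑ k R (max q.1 0) * θ.ν k) /
    (θ.ζ₁ k (max q.2 0) * θ.ϑ k R (max q.1 0))))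

lemma condOutage_of_nonneg {θ : Params} (hθ : θ.Valid) (k : User θ.K) {R s d : ℝ} (hR : 0 < R)
    (hs : 0 ≤ s) (hd : 0 ≤ d) :
    condOutage θ k R (s, d) = orderStatPoly θ k (θ.base k (θ.ζ₁ k d) (θ.ϑ k R s)) := by
  rw [condOutage, base_eq_gammaTail hθ k (ζ₁_pos hθ k hd) (ϑ_pos hθ k hR hs), max_eq_left hs,
    max_eq_left hd]

/-- Clamping at `0` keeps every denominator positive on the whole plane. Nothing is lost: the nodes
are positive and the exponential law lives on positive numbers. At `a_k = ϑ ν_k` continuity comes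
from `gammaTail`. -/
lemma continuous_condOutage {θ : Params} (hθ : θ.Valid) (k : User θ.K) {R : ℝ} (hR : 0 < R) :
    Continuous (condOutage θ k R) := by
  have h1 := hθ.Nr_one_pos k
  have h2 := hθ.Nbr_pos
  have h3 := hθ.Nipe_pos
  have h4 := hθ.ρe_pos
  have h5 := hθ.ϖ_mem.1
  have h6 := hθ.ν_nonneg k
  have hϑ : Continuous fun q : ℝ × ℝ => θ.ϑ k R (max q.1 0) := by
    unfold Params.ϑ
    refine (continuous_const.mul (continuous_const.add (continuous_const.div (by fun_prop)
      fun q => ?_))).sub continuous_const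
    have : 0 ≤ max q.1 0 := le_max_right _ _
    positivity
  have hζ : Continuous fun q : ℝ × ℝ => θ.ζ₁ k (max q.2 0) := by
    unfold Params.ζ₁
    fun_prop
  have hT : Continuous fun q : ℝ × ℝ => gammaTail θ.Q ((θ.a k - θ.ϑ k R (max q.1 0) * θ.ν k) /
      (θ.ζ₁ k (max q.2 0) * θ.ϑ k R (max q.1 0))) := by
    refine (continuous_gammaTail hθ.Q_pos).comp (Continuous.div (by fun_prop) (by fun_prop)
      fun q => ?_)
    exact (mul_pos (ζ₁_pos hθ k (le_max_right _ _)) (ϑ_pos hθ k hR (le_max_right _ _))).ne'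
  unfold condOutage orderStatPoly
  fun_prop

lemma norm_orderStatPoly_le (θ : Params) (k : ℕ) {F : ℝ} (hF : F ∈ Set.Icc (0 : ℝ) 1) :
    ‖orderStatPoly θ k F‖ ≤ ‖θ.κ k‖ * ∑ l ∈ Finset.range (θ.K - k + 1),
      ‖((θ.K - k).choose l : ℝ) * ((-1) ^ l / ((k : ℝ) + l))‖ := by
  rw [orderStatPoly, norm_mul]
  refine mul_le_mul_of_nonneg_left ((norm_sum_le _ _).trans (Finset.sum_le_sum fun l _ => ?_))
    (norm_nonneg _)
  rw [norm_mul _ (F ^ _), norm_pow, Real.norm_of_nonneg hF.1]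
  exact mul_le_of_le_one_right (norm_nonneg _) (pow_le_one₀ hF.1 hF.2)

lemma norm_condOutage_le {θ : Params} (hθ : θ.Valid) (k : ℕ) (R : ℝ) (q : ℝ × ℝ) :
    ‖condOutage θ k R q‖ ≤ ‖θ.κ k‖ * ∑ l ∈ Finset.range (θ.K - k + 1),
      ‖((θ.K - k).choose l : ℝ) * ((-1) ^ l / ((k : ℝ) + l))‖ := by
  refine norm_orderStatPoly_le θ k ?_
  have := gammaTail_mem_Icc hθ.Q_pos ((θ.a k - θ.ϑ k R (max q.1 0) * θ.ν k) /
    (θ.ζ₁ k (max q.2 0) * θ.ϑ k R (max q.1 0)))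
  exact ⟨by linarith [this.2], by linarith [this.1]⟩

lemma sopIpSIC_eq_sum {θ : Params} (hθ : θ.Valid) (k : User θ.K) {R : ℝ} (hR : 0 < R)
    (S D : ℕ) : θ.sopIpSIC k R S D =
      ∑ τs ∈ nodes S, ∑ τd ∈ nodes D, weight S τs * weight D τd * condOutage θ k R (τs, τd) := by
  rw [Params.sopIpSIC]
  refine Finset.sum_congr rfl fun τs hs => ?_
  rw [Finset.sum_comm]
  refine Finset.sum_congr rfl fun τd hd => ?_
  rw [condOutage_of_nonneg hθ k hR (nodes_pos hs).le (nodes_pos hd).le, orderStatPoly,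
    Finset.mul_sum, Finset.mul_sum]
  exact Finset.sum_congr rfl fun l _ => by ring

lemma tendsto_sopIpSIC {θ : Params} (hθ : θ.Valid) (k : User θ.K) {R : ℝ} (hR : 0 < R) :
    Tendsto (fun SD : ℕ × ℕ => θ.sopIpSIC k R SD.1 SD.2) (atTop ×ˢ atTop)
      (𝓝 (∫ q, condOutage θ k R q ∂((expMeasure 1).prod (expMeasure 1)))) := by
  simp_rw [sopIpSIC_eq_sum hθ k hR]
  exact tendsto_sum_sum_weight_mul (BoundedContinuousFunction.ofNormedAddCommGroup
    (condOutage θ k R) (continuous_condOutage hθ k hR) _ (norm_condOutage_le hθ k R))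

/-- Without residual interference neither `ζ₁` nor `ϑ` depends on its argument, so the conditional
outage probability is constant. -/
lemma condOutage_eq_sopPSIC {θ : Params} (hθ : θ.Valid) (k : User θ.K) {R : ℝ} (hR : 0 < R)
    (hϖ : θ.ϖ = 0) (q : ℝ × ℝ) : condOutage θ k R q = θ.sopPSIC k R := by
  have h1 : condOutage θ k R q = condOutage θ k R (max q.1 0, max q.2 0) := by
    simp [condOutage]
  have h2 : θ.ζ₁ k (max q.2 0) = (θ.ζ₂ k)⁻¹ := by simp [Params.ζ₁, Params.ζ₂, hϖ]
  have h3 : θ.ϑ k R (max q.1 0) = θ.ς k R := by simp [Params.ϑ, Params.ς, hϖ]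
  rw [h1, condOutage_of_nonneg hθ k hR (le_max_right _ _) (le_max_right _ _), h2, h3]
  rfl

lemma map_norm_sq_of_hasLaw {Ω : Type*} [MeasurableSpace Ω] {μ : Measure Ω} {X : Ω → ℂ} {N : ℝ}
    (hN : 0 < N) (hX : HasLaw X (complexNormal N) μ) :
    μ.map (fun ω => ‖X ω‖ ^ 2) = (expMeasure 1).map (fun x => N * x) := by
  rw [expMeasure_one, ← map_norm_sq_div_complexNormal hN,
    Measure.map_map (by fun_prop) (by fun_prop), ← hX.map_eq,
    AEMeasurable.map_map_of_aemeasurable (by fun_prop) hX.aemeasurable]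
  congr 1
  ext ω
  simp only [Function.comp]
  field_simp

lemma measurableSet_secrecyRate_lt (θ : Params) (k : ℕ) (R : ℝ) :
    MeasurableSet {q : ℝ × ℝ × ℝ × ℝ | secrecyRate (sinr θ k θ.ρ q.1 q.2.2.1)
      (sinr θ k θ.ρe q.2.1 q.2.2.2) < R} := by
  refine measurableSet_lt ?_ measurable_const
  unfold secrecyRate sinr Real.logb
  fun_prop

section
variable {Ω : Type*} [MeasurableSpace Ω] {μ : Measure Ω} [IsProbabilityMeasure μ] {θ : Params}
  {h : Coeff θ.K θ.P θ.Q → Ω → ℂ}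

/-- Fubini, with the gain of user `k` integrated first; the interference powers are unit
exponentials scaled by their means. The coordinates are swapped at the end because `condOutage`
takes the eavesdropper's interference first, whereas the joint law lists `|h_ipu|²` before
`|h_ipe|²`. -/
lemma approxSOP_eq_integral (hθ : θ.Valid) (hh : IsFading μ θ h) (p : Fin θ.P)
    (k : User θ.K) {R : ℝ} (hR : 0 < R) :
    approxSOP μ θ p h k R = ∫ q, condOutage θ k R q ∂((expMeasure 1).prod (expMeasure 1)) := by
  have := Measure.isProbabilityMeasure_map (aemeasurable_gain hh p k)
  have := isProbabilityMeasure_orderStatLaw k.2.1 k.2.2 (μ.map (gain θ p h k))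
  have hA := measurableSet_secrecyRate_lt θ k R
  have hm := measurable_measure_prodMk_right
    (μ := orderStatLaw θ.K k (μ.map (gain θ p h k))) hA
  have hm' : Measurable fun m : ℝ × ℝ => (orderStatLaw θ.K k (μ.map (gain θ p h k))
      ((fun x => (x, θ.Q * θ.Nbr * θ.Nr k.first, m)) ⁻¹' {q : ℝ × ℝ × ℝ × ℝ |
        secrecyRate (sinr θ k θ.ρ q.1 q.2.2.1) (sinr θ k θ.ρe q.2.1 q.2.2.2) < R})).toReal :=
    hm.ennreal_toReal.comp measurable_prodMk_left
  rw [approxSOP, sop, map_norm_sq_of_hasLaw hθ.Nipu_pos (hh.hasLaw .ipu),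
    map_norm_sq_of_hasLaw hθ.Nipe_pos (hh.hasLaw .ipe), (integral_gain hθ hh p k.first).2,
    Measure.map_prod_map _ _ (by fun_prop) (by fun_prop), Measure.dirac_prod, measureReal_def,
    Measure.prod_apply_symm hA,
    ← integral_toReal hm.aemeasurable (ae_of_all _ fun _ => measure_lt_top _ _),
    integral_map (by fun_prop) hm.ennreal_toReal.aestronglyMeasurable,
    integral_map (by fun_prop) hm'.aestronglyMeasurable,
    ← integral_prod_swap]
  refine integral_congr_ae ?_
  have h1 : ∀ᵐ x ∂expMeasure 1, 0 ≤ x := (ae_pos_gammaMeasure_one 1).mono fun x hx => hx.le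
  have h2 : ∀ᵐ q ∂(expMeasure 1).prod (expMeasure 1), 0 ≤ q.1 ∧ 0 ≤ q.2 :=
    (Measure.quasiMeasurePreserving_fst.ae h1).and (Measure.quasiMeasurePreserving_snd.ae h1)
  filter_upwards [h2] with q hq
  have := orderStatLaw_secrecyRate_lt hθ hh p k hR hq.1 hq.2
  rw [← condOutage_of_nonneg hθ k hR hq.1 hq.2] at this
  exact this

end

end RISNOMA

end

theorem theorem2 {Ω : Type*} [MeasurableSpace Ω] (μ : Measure Ω) [IsProbabilityMeasure μ]
    (θ : RISNOMA.Params) (hθ : θ.Valid) (p : Fin θ.P)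
    (h : RISNOMA.Coeff θ.K θ.P θ.Q → Ω → ℂ) (hh : RISNOMA.IsFading μ θ h)
    (k : RISNOMA.User θ.K) (hk : 1 < (k : ℕ)) (R : ℝ) (hR : 0 < R) :
    (Integrable (RISNOMA.gain θ p h k.first) μ ∧
      ∫ ω, RISNOMA.gain θ p h k.first ω ∂μ = θ.Q * θ.Nbr * θ.Nr 1) ∧
    Tendsto (fun SD : ℕ × ℕ => θ.sopIpSIC k R SD.1 SD.2) (atTop ×ˢ atTop)
      (𝓝 (RISNOMA.approxSOP μ θ p h k R)) ∧
    (θ.ϖ = 0 → RISNOMA.approxSOP μ θ p h k R = θ.sopPSIC k R) := by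
  refine ⟨RISNOMA.integral_gain hθ hh p k.first, ?_, fun hϖ => ?_⟩
  · rw [RISNOMA.approxSOP_eq_integral hθ hh p k hR]
    exact RISNOMA.tendsto_sopIpSIC hθ k hR
  · rw [RISNOMA.approxSOP_eq_integral hθ hh p k hR]
    simp [RISNOMA.condOutage_eq_sopPSIC hθ k hR hϖ]
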